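/- Let $n,d,T\ge 1$ be integers and $\rho,B>0$, $\alpha,\beta\in(0,1)$ real numbers. A dataset $X$ consists of $n$ records $x^{(1)},\dots,x^{(n)}\in\mathbb R^d$ with $|x^{(i)}_j|\le B$ for all $i,j$; two datasets are neighbouring ($X\sim X'$) if they differ in a single record. Put $\Sigma(X)=\frac1n\sum_i x^{(i)}x^{(i)\top}$ and $\Delta=2B^2/n$. For a randomized mechanism $\mathcal M$, $\rho$-zCDP means that $D_\gamma(\mathcal M(X)\,\|\,\mathcal M(X'))\le\rho\gamma$ for all $X\sim X'$ and all $\gamma>1$, where $D_\gamma$ is the Rényi divergence of order $\gamma$. The algorithm PACE-GGM runs on $X$ as follows; entries are indexed by pairs $(j,k)$ with $j\ge k$, and all noise and all random choices are drawn independently given the past. 1. Initialization. Set $y_{jk}=\lambda_{jk}=0$ for all $j\ge k$. For each $j$ set $y_{jj}=\Sigma_{jj}(X)+\mathcal N(0,\sigma^2)$ and $\lambda_{jj}=\sigma^{-2}$, where $\sigma^2=\Delta^2/(2\alpha\rho/d)$. Set $\hat\Sigma^{(0)}=\mathrm{diag}(\max(y_{11},0),\dots,\max(y_{dd},0))$,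 $\rho_{\rm used}=\alpha\rho$, $\rho_{\rm sel}=\beta(1-\alpha)\rho/T$, $\rho_{\rm meas}=(1-\beta)(1-\alpha)\rho/T$, $t=0$. 2. While $\rho_{\rm used}<\rho$, increase $t$ by $1$ and do the following. (a) Select an entry $(j,k)$ with probability proportional to $\exp\bigl(\frac{\epsilon}{2\Delta}|\Sigma_{jk}(X)-\hat\Sigma^{(t-1)}_{jk}|\bigr)$, where $\epsilon=\sqrt{8\rho_{\rm sel}}$. (b) Measure $z=\Sigma_{jk}(X)+\mathcal N(0,\sigma_t^2)$, $\sigma_t^2=\Delta^2/(2\rho_{\rm meas})$, and update $y_{jk}\leftarrow(\lambda_{jk}y_{jk}+\sigma_t^{-2}z)/(\lambda_{jk}+\sigma_t^{-2})$, then $\lambda_{jk}\leftarrow\lambda_{jk}+\sigma_t^{-2}$. (c) Let $\hat\Sigma^{(t)}$ be the maximum-entropy reconstruction $\arg\max\{\log|\Sigma|:\Sigma\in\arg\min_{W\succeq0}L(W)\}$, $L(W)=\sum_{j\ge k}\lambda_{jk}(W_{jk}-y_{jk})^2$, defined (also when all minimizers of $L$ are singular) as the limit as $\mu\to0^+$ of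 the unique minimizer of $L(W)-\mu\log|W|$ over $W\succeq0$. (d) Set $\rho_{\rm used}\leftarrow\rho_{\rm used}+\rho_{\rm sel}+\rho_{\rm meas}$. If $|\hat\Sigma^{(t)}_{jk}-\hat\Sigma^{(t-1)}_{jk}|\le\sqrt{2/\pi}\,\sigma_t$, replace $\rho_{\rm sel}$ by $2\rho_{\rm sel}$ and $\rho_{\rm meas}$ by $4\rho_{\rm meas}$. Then, if $\rho-\rho_{\rm used}<2(\rho_{\rm sel}+\rho_{\rm meas})$, set $\rho_{\rm sel}=\beta(\rho-\rho_{\rm used})$ and $\rho_{\rm meas}=(1-\beta)(\rho-\rho_{\rm used})$. 3. Return $\hat\Sigma^{(t)}$. Theorem. The quantity $\Delta$ bounds the sensitivity of every entry: $|\Sigma_{jk}(X)-\Sigma_{jk}(X')|\le 2B^2/n$ for all $X\sim X'$ and all $j,k$. The algorithm terminates with probability $1$, so that its output has a probability law for each dataset $X$, and the mechanism $X\mapsto\hat\Sigma^{(t)}$ that it defines satisfies $\rho$-zCDP. -/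

import Mathlib

open MeasureTheory ProbabilityTheory Filter Topology
open scoped ENNReal Matrix

noncomputable section

namespace PaceGGM

/-! ### Zero-concentrated differential privacy -/

/-- The Rényi divergence `D_γ(P ‖ Q) = (γ - 1)⁻¹ log ∫ (dP/dQ)^γ dQ` of order `γ > 1` of two
probability measures; it is `+∞` when `P` is not absolutely continuous with respect to `Q`. -/
def renyiDiv {Ω : Type*} [MeasurableSpace Ω] (γ : ℝ) (P Q : Measure Ω) : EReal :=
  open Classical in
  if P ≪ Q then (((γ - 1)⁻¹ : ℝ) : EReal) * ENNReal.log (∫⁻ x, (P.rnDeriv Q x) ^ γ ∂Q) else ⊤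

/-- A mechanism maps a dataset to the law of its random output. It is `ρ`-zCDP for the given
neighbouring relation if `D_γ(M X ‖ M X') ≤ ρ γ` for all neighbouring `X, X'` and all `γ > 1`. -/
def IsZCDP {𝒟 Ω : Type*} [MeasurableSpace Ω] (nbr : 𝒟 → 𝒟 → Prop) (M : 𝒟 → Measure Ω)
    (ρ : ℝ) : Prop :=
  ∀ X X' : 𝒟, nbr X X' → ∀ γ : ℝ, 1 < γ → renyiDiv γ (M X) (M X') ≤ ((ρ * γ : ℝ) : EReal)

/-! ### Datasets -/

/-- A record: a vector of `ℝ^d` with all coordinates bounded by `B` in absolute value. -/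
abbrev Record (d : ℕ) (B : ℝ) : Type := {x : Fin d → ℝ // ∀ j, |x j| ≤ B}

/-- A dataset of `n` records. -/
abbrev Dataset (n d : ℕ) (B : ℝ) : Type := Fin n → Record d B

/-- Two datasets (of the same size) are neighbouring if they differ in a single record. -/
def Neighboring {n d : ℕ} {B : ℝ} (X X' : Dataset n d B) : Prop :=
  ∃ i, X i ≠ X' i ∧ ∀ k, k ≠ i → X k = X' k

/-- The `n × d` data matrix whose rows are the records. -/
def dataMatrix {n d : ℕ} {B : ℝ} (X : Dataset n d B) : Matrix (Fin n) (Fin d) ℝ :=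
  Matrix.of fun i j => (X i).1 j

/-- The empirical second-moment matrix `Σ(X) = (1/n) Xᵀ X`. -/
def secondMoment {n d : ℕ} {B : ℝ} (X : Dataset n d B) : Matrix (Fin d) (Fin d) ℝ :=
  (n : ℝ)⁻¹ • ((dataMatrix X)ᵀ * dataMatrix X)

/-- The entries `(j, k)` with `j ≥ k` (lower triangle, diagonal included). -/
abbrev Entry (d : ℕ) : Type := {p : Fin d × Fin d // p.2 ≤ p.1}

/-- The value of a matrix at an entry of the lower triangle. -/
def entryOf {d : ℕ} (W : Matrix (Fin d) (Fin d) ℝ) (e : Entry d) : ℝ := W e.1.1 e.1.2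

/-! ### Maximum-entropy reconstruction -/

/-- The weighted squared error `L(W) = ∑_{j ≥ k} λ_{jk} (W_{jk} - y_{jk})²`. -/
def loss {d : ℕ} (y lam : Entry d → ℝ) (W : Matrix (Fin d) (Fin d) ℝ) : ℝ :=
  ∑ e : Entry d, lam e * (entryOf W e - y e) ^ 2

/-- `W` minimizes `L(W) - μ log |W|`. Since `log 0 = -∞`, singular positive semidefinite matrices
have objective value `+∞`, so that the minimization is over the positive definite matrices. -/
def IsBarrierMin {d : ℕ} (y lam : Entry d → ℝ) (μ : ℝ) (W : Matrix (Fin d) (Fin d) ℝ) : Prop :=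
  W.PosDef ∧ ∀ V : Matrix (Fin d) (Fin d) ℝ, V.PosDef →
    loss y lam W - μ * Real.log W.det ≤ loss y lam V - μ * Real.log V.det

/-- The minimizer `Σ*_μ` of the barrier-penalized problem (it exists and is unique if `μ > 0`,
all precisions are nonnegative and all diagonal precisions are positive). -/
def barrierMinimizer {d : ℕ} (y lam : Entry d → ℝ) (μ : ℝ) : Matrix (Fin d) (Fin d) ℝ :=
  Classical.epsilon (IsBarrierMin y lam μ)

/-- Maximum-entropy reconstruction from averaged measurements `y` with precisions `lam`: the limit
as `μ → 0+` of the minimizers of `L(W) - μ log |W|`. This is the maximizer of `log |Σ|` among the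
minimizers of `L` over positive semidefinite matrices if one of those is nonsingular; otherwise all
of them have `log |Σ| = -∞` and the limit is the convention that selects one.
Reconstruction is only ever called with all diagonal entries measured; other inputs are sent
to `0`. -/
def maxEntReconstruction {d : ℕ} (y lam : Entry d → ℝ) : Matrix (Fin d) (Fin d) ℝ :=
  open Classical in
  if (∀ e, 0 ≤ lam e) ∧ (∀ e : Entry d, e.1.1 = e.1.2 → 0 < lam e) then
    limUnder (𝓝[>] (0 : ℝ)) (fun μ => barrierMinimizer y lam μ)
  else 0

/-! ### The algorithm -/

/-- Parameters of the algorithm: maximal number of rounds `T`, total budget `ρ`, coordinate-wise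
bound `B`, fraction `α` of the budget for the initialization, and fraction `β` of the budget of a
round for the selection. -/
structure Params where
  T : ℕ
  ρ : ℝ
  B : ℝ
  α : ℝ
  β : ℝ

/-- The variables of the algorithm: averaged measurements, precisions, the current estimate, the
budget used so far and the current budgets for selection and measurement. -/
structure State (d : ℕ) where
  y : Entry d → ℝ
  lam : Entry d → ℝ
  est : Matrix (Fin d) (Fin d) ℝ
  used : ℝ
  sel : ℝ
  meas : ℝ

/-- Matrices carry the product σ-algebra. -/
instance instMeasurableSpaceMatrix (d : ℕ) : MeasurableSpace (Matrix (Fin d) (Fin d) ℝ) :=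
  inferInstanceAs (MeasurableSpace (Fin d → Fin d → ℝ))

/-- A state as a tuple. -/
def State.toTuple {d : ℕ} (s : State d) :
    (Entry d → ℝ) × (Entry d → ℝ) × Matrix (Fin d) (Fin d) ℝ × ℝ × ℝ × ℝ :=
  (s.y, s.lam, s.est, s.used, s.sel, s.meas)

/-- States carry the product σ-algebra. -/
instance instMeasurableSpaceState (d : ℕ) : MeasurableSpace (State d) :=
  MeasurableSpace.comap State.toTuple inferInstance

/-- The per-entry sensitivity `Δ = 2 B² / n`. -/
def Params.sens (P : Params) (n : ℕ) : ℝ := 2 * P.B ^ 2 / n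

/-- The initial budget of a round, `(ρ - αρ) / T`. -/
def Params.perRound (P : Params) : ℝ := (P.ρ - P.α * P.ρ) / P.T

/-- The variance of the noise in the initialization, `Δ² / (2 ρ_diag / d)` with `ρ_diag = αρ`. -/
def Params.diagVar (P : Params) (n d : ℕ) : ℝ := P.sens n ^ 2 / (2 * (P.α * P.ρ) / d)

/-- The state after the initialization, given the noisy diagonal `v`. -/
def initState (n : ℕ) {d : ℕ} (P : Params) (v : Fin d → ℝ) : State d where
  y := fun e => if e.1.1 = e.1.2 then v e.1.1 else 0
  lam := fun e => if e.1.1 = e.1.2 then (P.diagVar n d)⁻¹ else 0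
  est := Matrix.diagonal fun j => max (v j) 0
  used := P.α * P.ρ
  sel := P.β * P.perRound
  meas := (1 - P.β) * P.perRound

/-- The initialization: every diagonal entry is measured with independent Gaussian noise. -/
def initLaw {n d : ℕ} (P : Params) (X : Dataset n d P.B) : Measure (State d) :=
  (Measure.pi fun j : Fin d =>
    gaussianReal (secondMoment X j j) (P.diagVar n d).toNNReal).map (initState n P)

/-- The exponential mechanism: `r` is drawn with probability proportional to
`exp (c * score r)`. -/
def expMechanism {R : Type*} [Fintype R] [MeasurableSpace R] (c : ℝ) (score : R → ℝ) :
    Measure R :=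
  ∑ r, ENNReal.ofReal (Real.exp (c * score r) / ∑ r', Real.exp (c * score r')) • Measure.dirac r

/-- The selection step: the exponential mechanism with `c = ε / (2Δ)`, `ε = √(8 ρ_sel)`, and score
`err(j, k) = |Σ_{jk}(X) - Σ̂_{jk}|`. -/
def selectLaw {n d : ℕ} (P : Params) (X : Dataset n d P.B) (s : State d) : Measure (Entry d) :=
  expMechanism (Real.sqrt (8 * s.sel) / (2 * P.sens n))
    (fun e => |entryOf (secondMoment X) e - entryOf s.est e|)

/-- The variance `σ_t² = Δ² / (2 ρ_meas)` of the noise of the measurement. -/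
def measVar (n : ℕ) {d : ℕ} (P : Params) (s : State d) : ℝ := P.sens n ^ 2 / (2 * s.meas)

/-- The budgets `(ρ_sel, ρ_meas)` after annealing, where `change` is the absolute change of the
estimate of the entry measured last, `var` the variance of its noise, and `used` the updated used
budget. -/
def anneal (P : Params) (change var used sel meas : ℝ) : ℝ × ℝ :=
  open Classical in
  let b : ℝ × ℝ :=
    if change ≤ Real.sqrt (2 / Real.pi) * Real.sqrt var then (2 * sel, 4 * meas) else (sel, meas)
  if P.ρ - used < 2 * (b.1 + b.2) then (P.β * (P.ρ - used), (1 - P.β) * (P.ρ - used)) else b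

/-- The (deterministic) remainder of a round: update of the precision-weighted average and of the
precision with the measurement `z` of the entry `e`, reconstruction, accounting, annealing. -/
def updateState (n : ℕ) {d : ℕ} (P : Params) (s : State d) (e : Entry d) (z : ℝ) : State d :=
  let prec : ℝ := (measVar n P s)⁻¹
  let y' := Function.update s.y e ((s.lam e * s.y e + prec * z) / (s.lam e + prec))
  let lam' := Function.update s.lam e (s.lam e + prec)
  let est' := maxEntReconstruction y' lam'
  let used' := s.used + s.sel + s.meas
  let b := anneal P |entryOf est' e - entryOf s.est e| (measVar n P s) used' s.sel s.meas
  { y := y', lam := lam', est := est', used := used', sel := b.1, meas := b.2 }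

/-- One round of the loop: select an entry, measure it with Gaussian noise, update. -/
def roundLaw {n d : ℕ} (P : Params) (X : Dataset n d P.B) (s : State d) : Measure (State d) :=
  (selectLaw P X s).bind fun e =>
    (gaussianReal (entryOf (secondMoment X) e) (measVar n P s).toNNReal).map
      (updateState n P s e)

/-- The law of the final state of a while loop with random body, started at `s`, restricted to the
event that the body is executed exactly `k` times. -/
def haltsAfter {S : Type*} [MeasurableSpace S] (guard : S → Prop) (body : S → Measure S) :
    ℕ → S → Measure S
  | 0, s => open Classical in if guard s then 0 else Measure.dirac s
  | k + 1, s => open Classical in if guard s then (body s).bind (haltsAfter guard body k) else 0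

/-- The law of the final state of a while loop with random body, started at `s` (of total mass the
probability that the loop terminates). -/
def whileLaw {S : Type*} [MeasurableSpace S] (guard : S → Prop) (body : S → Measure S) (s : S) :
    Measure S :=
  Measure.sum fun k => haltsAfter guard body k s

/-- The whole algorithm: initialization, then rounds while the used budget is less than `ρ`; the
output is the last estimate. -/
def pace {n d : ℕ} (P : Params) (X : Dataset n d P.B) : Measure (Matrix (Fin d) (Fin d) ℝ) :=
  ((initLaw P X).bind (whileLaw (fun s : State d => s.used < P.ρ) (roundLaw P X))).map State.est

end PaceGGM

end

/-!
The privacy proof composes bounds without densities of the composed laws. For `γ > 1` with conjugate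
exponent `q`, `D_γ(P ‖ Q) ≤ γ ρ` says that the functional `g ↦ E_P g` has norm at most
`exp ((γ - 1) ρ)` on `L^q(Q)`; this is `DualRenyiBound`. In this form
adaptive composition (`DualRenyiBound.bind`) and post-processing (`DualRenyiBound.map`) are
immediate: integrate out the last step first and insert its bound into the bound of the step before.
`DualRenyiBound.renyiDiv_le` returns to the divergence.

The two primitives are Gaussian noise, whose likelihood ratio has explicit moments
(`dualRenyiBound_gaussianReal`), and the exponential mechanism, whose log-likelihood ratio lies in
an interval of length `ε`; Hoeffding's lemma gives the sharp cost `ε² / 8`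
(`dualRenyiBound_of_logRatio_mem_Icc`), which is `ρ_sel` for `ε = √(8 ρ_sel)`.

The budgets of later rounds depend on the noise, but the used budget after a round is determined by
the state before it. So from a state with used budget `u` the rest of the loop costs at most `ρ - u`
(`dualRenyiBound_loopLaw`), by induction over the rounds. Each round either costs at least the
initial budget of a round or exhausts the total (`LoopInv`), so that the number of rounds is
bounded; this gives termination and makes the induction finite.

All laws are composed with `Measure.bind`, which requires the reconstruction to be measurable
(`measurable_maxEntReconstruction`). For `μ > 0` the minimizer of `L(W) - μ log |W|` exists by
coercivity, is unique by strict log-concavity of the determinant, and depends continuously on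
`(y, λ, μ)`. By continuity in `μ` the limit at `0+` can be taken along the positive rationals, and
limits along countable families of measurable maps are measurable.
-/

noncomputable section

namespace PaceGGM

section DualRenyi

/-! ### The dual form of a bound on the Rényi divergence -/

/-- The bound `D_γ(P ‖ Q) ≤ γ ρ` in dual form. Since `(E_Q (dP/dQ)^γ)^(1/γ)` is the norm of the
functional `g ↦ E_P g` on `L^q(Q)`, where `q = γ / (γ - 1)`, the divergence is at most `γ ρ` iff
this functional has norm at most `exp ((γ - 1) ρ)`. No density occurs in this form. -/
def DualRenyiBound {Ω : Type*} [MeasurableSpace Ω] (γ ρ : ℝ) (P Q : Measure Ω) : Prop :=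
  ∀ g : Ω → ℝ≥0∞, Measurable g → ∫⁻ x, g x ∂P ≤
    ENNReal.ofReal (Real.exp ((γ - 1) * ρ)) *
      (∫⁻ x, g x ^ γ.conjExponent ∂Q) ^ (1 / γ.conjExponent)

variable {Ω Ω' : Type*} [MeasurableSpace Ω] [MeasurableSpace Ω'] {γ ρ ρ₁ ρ₂ : ℝ}

lemma DualRenyiBound.mono {P Q : Measure Ω} (hγ : 1 < γ) (h : DualRenyiBound γ ρ₁ P Q)
    (hρ : ρ₁ ≤ ρ₂) : DualRenyiBound γ ρ₂ P Q := by
  intro g hg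
  refine (h g hg).trans ?_
  gcongr

lemma dualRenyiBound_dirac (hγ : 1 < γ) (a : Ω) :
    DualRenyiBound γ 0 (Measure.dirac a) (Measure.dirac a) := by
  intro g hg
  have hq := (Real.HolderConjugate.conjExponent hγ).symm.pos
  rw [lintegral_dirac' _ hg, lintegral_dirac' _ (by fun_prop), ← ENNReal.rpow_mul,
    mul_one_div_cancel hq.ne']
  simp

lemma DualRenyiBound.map {P Q : Measure Ω} (h : DualRenyiBound γ ρ P Q) {f : Ω → Ω'}
    (hf : Measurable f) : DualRenyiBound γ ρ (P.map f) (Q.map f) := by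
  intro g hg
  rw [lintegral_map hg hf, lintegral_map (by fun_prop) hf]
  exact h _ (hg.comp hf)

/-- Adaptive composition, in terms of iterated integrals. -/
lemma lintegral_lintegral_le_of_dualRenyiBound (hγ : 1 < γ) {P Q : Measure Ω}
    (h : DualRenyiBound γ ρ₁ P Q) {κ κ' : Ω → Measure Ω'}
    (hκκ' : ∀ a, DualRenyiBound γ ρ₂ (κ a) (κ' a)) {g : Ω → Ω' → ℝ≥0∞}
    (hg : ∀ a, Measurable (g a))
    (hg' : Measurable fun a => ∫⁻ b, g a b ^ γ.conjExponent ∂κ' a) :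
    ∫⁻ a, ∫⁻ b, g a b ∂κ a ∂P ≤ ENNReal.ofReal (Real.exp ((γ - 1) * (ρ₁ + ρ₂))) *
      (∫⁻ a, ∫⁻ b, g a b ^ γ.conjExponent ∂κ' a ∂Q) ^ (1 / γ.conjExponent) := by
  have hq := (Real.HolderConjugate.conjExponent hγ).symm.pos
  calc ∫⁻ a, ∫⁻ b, g a b ∂κ a ∂P
      ≤ ∫⁻ a, ENNReal.ofReal (Real.exp ((γ - 1) * ρ₂)) *
          (∫⁻ b, g a b ^ γ.conjExponent ∂κ' a) ^ (1 / γ.conjExponent) ∂P :=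
        lintegral_mono fun a => hκκ' a _ (hg a)
    _ = ENNReal.ofReal (Real.exp ((γ - 1) * ρ₂)) *
          ∫⁻ a, (∫⁻ b, g a b ^ γ.conjExponent ∂κ' a) ^ (1 / γ.conjExponent) ∂P :=
        lintegral_const_mul _ (by fun_prop)
    _ ≤ ENNReal.ofReal (Real.exp ((γ - 1) * ρ₂)) *
          (ENNReal.ofReal (Real.exp ((γ - 1) * ρ₁)) *
          (∫⁻ a, ((∫⁻ b, g a b ^ γ.conjExponent ∂κ' a) ^ (1 / γ.conjExponent)) ^ γ.conjExponent
            ∂Q) ^ (1 / γ.conjExponent)) := by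
        gcongr
        exact h _ (by fun_prop)
    _ = _ := by
        rw [← mul_assoc, ← ENNReal.ofReal_mul (Real.exp_pos _).le, ← Real.exp_add]
        simp only [← ENNReal.rpow_mul, one_div_mul_cancel hq.ne', ENNReal.rpow_one]
        congr 4
        ring

lemma DualRenyiBound.bind (hγ : 1 < γ) {P Q : Measure Ω} (h : DualRenyiBound γ ρ₁ P Q)
    {κ κ' : Ω → Measure Ω'} (hκ : Measurable κ) (hκ' : Measurable κ')
    (hκκ' : ∀ a, DualRenyiBound γ ρ₂ (κ a) (κ' a)) :
    DualRenyiBound γ (ρ₁ + ρ₂) (P.bind κ) (Q.bind κ') := by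
  intro g hg
  have hgq : Measurable fun b => g b ^ γ.conjExponent := by fun_prop
  rw [Measure.lintegral_bind hκ.aemeasurable hg.aemeasurable,
    Measure.lintegral_bind hκ'.aemeasurable hgq.aemeasurable]
  exact lintegral_lintegral_le_of_dualRenyiBound hγ h hκκ' (g := fun _ => g) (fun _ => hg)
    ((Measure.measurable_lintegral hgq).comp hκ')

lemma DualRenyiBound.prod (hγ : 1 < γ) {P Q : Measure Ω} {P' Q' : Measure Ω'} [SFinite P']
    [SFinite Q'] (h : DualRenyiBound γ ρ₁ P Q) (h' : DualRenyiBound γ ρ₂ P' Q') :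
    DualRenyiBound γ (ρ₁ + ρ₂) (P.prod P') (Q.prod Q') := by
  intro g hg
  have hgq : Measurable fun b => g b ^ γ.conjExponent := by fun_prop
  rw [lintegral_prod _ hg.aemeasurable, lintegral_prod _ hgq.aemeasurable]
  exact lintegral_lintegral_le_of_dualRenyiBound hγ h (fun _ => h')
    (g := fun a b => g (a, b)) (fun a => by fun_prop) hgq.lintegral_prod_right'

lemma DualRenyiBound.pi (hγ : 1 < γ) {d : ℕ} {P Q : Fin d → Measure Ω}
    [∀ i, IsProbabilityMeasure (P i)] [∀ i, IsProbabilityMeasure (Q i)]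
    (h : ∀ i, DualRenyiBound γ ρ (P i) (Q i)) :
    DualRenyiBound γ (d * ρ) (Measure.pi P) (Measure.pi Q) := by
  induction d with
  | zero =>
    rw [Measure.pi_of_empty P, Measure.pi_of_empty Q]
    simpa using dualRenyiBound_dirac hγ _
  | succ d ih =>
    have hP := (measurePreserving_piFinSuccAbove P 0).symm
    have hQ := (measurePreserving_piFinSuccAbove Q 0).symm
    rw [← hP.map_eq, ← hQ.map_eq]
    refine DualRenyiBound.map ?_ (MeasurableEquiv.measurable _)
    have := (h 0).prod hγ (ih fun i => h (Fin.succAbove 0 i))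
    convert this using 1
    push_cast
    ring

/-- Hölder's inequality turns a moment bound for a density into the dual bound. -/
lemma dualRenyiBound_of_density (hγ : 1 < γ) {P Q : Measure Ω} {f : Ω → ℝ≥0∞}
    (hf : Measurable f) (hPQ : ∀ g : Ω → ℝ≥0∞, Measurable g → ∫⁻ x, g x ∂P = ∫⁻ x, f x * g x ∂Q)
    (h : ∫⁻ x, f x ^ γ ∂Q ≤ ENNReal.ofReal (Real.exp (γ * (γ - 1) * ρ))) :
    DualRenyiBound γ ρ P Q := by
  intro g hg
  have h0 : (0 : ℝ) < γ := by linarith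
  rw [hPQ g hg]
  refine (ENNReal.lintegral_mul_le_Lp_mul_Lq Q (Real.HolderConjugate.conjExponent hγ)
    hf.aemeasurable hg.aemeasurable).trans ?_
  gcongr
  refine (ENNReal.rpow_le_rpow h (by positivity)).trans_eq ?_
  rw [ENNReal.ofReal_rpow_of_pos (Real.exp_pos _), ← Real.exp_mul]
  congr 2
  field_simp

lemma DualRenyiBound.absolutelyContinuous (hγ : 1 < γ) {P Q : Measure Ω}
    (h : DualRenyiBound γ ρ P Q) : P ≪ Q := by
  have hq := (Real.HolderConjugate.conjExponent hγ).symm.pos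
  refine Measure.AbsolutelyContinuous.mk fun s hs hQs => ?_
  have := h (s.indicator 1) (measurable_one.indicator hs)
  have hsq : ∀ x, s.indicator (1 : Ω → ℝ≥0∞) x ^ γ.conjExponent = s.indicator 1 x := by
    intro x
    by_cases hx : x ∈ s <;> simp [hx, hq]
  simp only [hsq, lintegral_indicator_one hs, hQs] at this
  simpa [hq] using this

/-- The moment bound for the density, by testing the dual bound on powers of the truncated
density. -/
lemma DualRenyiBound.lintegral_rnDeriv_rpow_le (hγ : 1 < γ) {P Q : Measure Ω}
    [IsFiniteMeasure P] [IsFiniteMeasure Q] (h : DualRenyiBound γ ρ P Q) :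
    ∫⁻ x, P.rnDeriv Q x ^ γ ∂Q ≤ ENNReal.ofReal (Real.exp (γ * (γ - 1) * ρ)) := by
  have hconj := Real.HolderConjugate.conjExponent hγ
  have h0 : (0 : ℝ) < γ := by linarith
  have hf : Measurable (P.rnDeriv Q) := Measure.measurable_rnDeriv P Q
  set f := P.rnDeriv Q with hfdef
  -- Truncation at `n` makes the moment finite, so that it can be divided out below.
  have htrunc : ∀ n : ℕ, ∫⁻ x, min (f x) n ^ γ ∂Q ≤
      ENNReal.ofReal (Real.exp (γ * (γ - 1) * ρ)) := by
    intro n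
    set A := ∫⁻ x, min (f x) n ^ γ ∂Q with hA
    have hfin : A ≠ ⊤ := by
      refine ((lintegral_mono (g := fun _ => (n : ℝ≥0∞) ^ γ) fun x =>
        ENNReal.rpow_le_rpow (min_le_right _ _) h0.le).trans_lt ?_).ne
      rw [lintegral_const]
      exact ENNReal.mul_lt_top (ENNReal.rpow_lt_top_of_nonneg h0.le (by simp)) (measure_lt_top _ _)
    have hle : A ≤ ENNReal.ofReal (Real.exp ((γ - 1) * ρ)) * A ^ (1 / γ.conjExponent) := by
      have h1 := h (fun x => min (f x) n ^ (γ - 1)) (by fun_prop)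
      simp only [← ENNReal.rpow_mul] at h1
      rw [show (γ - 1) * γ.conjExponent = γ by
        rw [Real.conjExponent]; field_simp [sub_ne_zero.2 hγ.ne']] at h1
      refine le_trans ?_ h1
      rw [← Measure.withDensity_rnDeriv_eq P Q (h.absolutelyContinuous hγ),
        lintegral_withDensity_eq_lintegral_mul _ hf (by fun_prop)]
      refine lintegral_mono fun x => ?_
      rw [show γ = 1 + (γ - 1) by ring, ENNReal.rpow_add_of_nonneg _ _ zero_le_one (by linarith),
        ENNReal.rpow_one]
      simp only [Pi.mul_apply, add_sub_cancel_left]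
      gcongr
      exact min_le_left _ _
    rcases eq_or_ne A 0 with hA0 | hA0
    · simp [hA0]
    -- Divide by `A ^ (1 / q)`, which is finite and nonzero, and use `1 - 1 / q = 1 / γ`.
    have hsplit : A = A ^ (1 / γ) * A ^ (1 / γ.conjExponent) := by
      rw [← ENNReal.rpow_add _ _ hA0 hfin, one_div, one_div, hconj.inv_add_inv_eq_one,
        ENNReal.rpow_one]
    have hroot : A ^ (1 / γ) ≤ ENNReal.ofReal (Real.exp ((γ - 1) * ρ)) := by
      refine (ENNReal.mul_le_mul_iff_left (c := A ^ (1 / γ.conjExponent)) ?_ ?_).1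
        (hsplit.symm.trans_le hle)
      · simp [hA0, hfin]
      · simp [hA0, hfin]
    calc A = (A ^ (1 / γ)) ^ γ := by
          rw [← ENNReal.rpow_mul, one_div_mul_cancel h0.ne', ENNReal.rpow_one]
      _ ≤ ENNReal.ofReal (Real.exp ((γ - 1) * ρ)) ^ γ := ENNReal.rpow_le_rpow hroot h0.le
      _ = _ := by
          rw [ENNReal.ofReal_rpow_of_pos (Real.exp_pos _), ← Real.exp_mul]
          congr 2
          ring
  have hmono : Monotone fun (n : ℕ) x => min (f x) (n : ℝ≥0∞) ^ γ := by
    intro n m hnm x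
    dsimp only
    gcongr
  have hsup : ∀ x, f x ^ γ = ⨆ n : ℕ, min (f x) (n : ℝ≥0∞) ^ γ := by
    intro x
    refine le_antisymm ?_ (iSup_le fun n => ENNReal.rpow_le_rpow (min_le_left _ _) h0.le)
    have ht : Tendsto (fun n : ℕ => min (f x) (n : ℝ≥0∞) ^ γ) atTop (𝓝 (f x ^ γ)) := by
      have : Tendsto (fun n : ℕ => min (f x) (n : ℝ≥0∞)) atTop (𝓝 (min (f x) ⊤)) :=
        tendsto_const_nhds.min ENNReal.tendsto_nat_nhds_top
      rw [min_top_right] at this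
      exact (ENNReal.continuous_rpow_const.tendsto _).comp this
    exact le_of_tendsto' ht fun n => le_iSup (fun n : ℕ => min (f x) (n : ℝ≥0∞) ^ γ) n
  simp only [hsup]
  rw [lintegral_iSup (fun n => by fun_prop) hmono]
  exact iSup_le htrunc

lemma DualRenyiBound.renyiDiv_le (hγ : 1 < γ) {P Q : Measure Ω} [IsFiniteMeasure P]
    [IsFiniteMeasure Q] (h : DualRenyiBound γ ρ P Q) :
    renyiDiv γ P Q ≤ ((ρ * γ : ℝ) : EReal) := by
  have hγ' : 0 < γ - 1 := by linarith
  rw [renyiDiv, if_pos (h.absolutelyContinuous hγ)]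
  have h1 : ENNReal.log (∫⁻ x, P.rnDeriv Q x ^ γ ∂Q) ≤ ((γ * (γ - 1) * ρ : ℝ) : EReal) := by
    have := ENNReal.log_le_log (h.lintegral_rnDeriv_rpow_le hγ)
    rwa [ENNReal.log_ofReal_of_pos (Real.exp_pos _), Real.log_exp] at this
  refine (mul_le_mul_of_nonneg_left h1 (EReal.coe_nonneg.2 (inv_nonneg.2 hγ'.le))).trans_eq ?_
  rw [← EReal.coe_mul]
  congr 1
  field_simp

/-! ### The Gaussian mechanism and the exponential mechanism -/

lemma lintegral_gaussianReal_change_mean (m m' : ℝ) {v : NNReal} (hv : v ≠ 0) {g : ℝ → ℝ≥0∞}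
    (hg : Measurable g) :
    ∫⁻ x, g x ∂gaussianReal m v =
      ∫⁻ x, ENNReal.ofReal (Real.exp ((m - m') / v * x - (m ^ 2 - m' ^ 2) / (2 * v))) * g x
        ∂gaussianReal m' v := by
  have hv' : (v : ℝ) ≠ 0 := by exact_mod_cast hv
  rw [gaussianReal_of_var_ne_zero _ hv, gaussianReal_of_var_ne_zero _ hv,
    lintegral_withDensity_eq_lintegral_mul _ (measurable_gaussianPDF _ _) hg,
    lintegral_withDensity_eq_lintegral_mul _ (measurable_gaussianPDF _ _) (by fun_prop)]
  refine lintegral_congr fun x => ?_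
  simp only [Pi.mul_apply, gaussianPDF_def]
  rw [← mul_assoc, ← ENNReal.ofReal_mul (gaussianPDFReal_nonneg _ _ _)]
  congr 2
  simp only [gaussianPDFReal_def]
  rw [mul_assoc (√_)⁻¹, ← Real.exp_add]
  congr 2
  field_simp
  ring

/-- The Gaussian mechanism: changing the mean by `m - m'` costs `(m - m')² / (2 v)`. -/
lemma dualRenyiBound_gaussianReal (hγ : 1 < γ) {m m' : ℝ} {v : NNReal} (hv : v ≠ 0)
    (h : (m - m') ^ 2 / (2 * v) ≤ ρ) :
    DualRenyiBound γ ρ (gaussianReal m v) (gaussianReal m' v) := by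
  have hv' : (v : ℝ) ≠ 0 := by exact_mod_cast hv
  refine DualRenyiBound.mono hγ ?_ h
  refine dualRenyiBound_of_density hγ (by fun_prop)
    (fun g hg => lintegral_gaussianReal_change_mean m m' hv hg) ?_
  have h1 : ∀ x : ℝ, ENNReal.ofReal
      (Real.exp ((m - m') / v * x - (m ^ 2 - m' ^ 2) / (2 * v))) ^ γ =
      ENNReal.ofReal (Real.exp (-(γ * (m ^ 2 - m' ^ 2) / (2 * v))) *
        Real.exp (γ * (m - m') / v * x)) := by
    intro x
    rw [ENNReal.ofReal_rpow_of_pos (Real.exp_pos _), ← Real.exp_mul, ← Real.exp_add]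
    congr 2
    field_simp
    ring
  simp only [h1]
  rw [← ofReal_integral_eq_lintegral_ofReal
    ((integrable_exp_mul_gaussianReal _).const_mul _) (ae_of_all _ fun x => by positivity),
    integral_const_mul]
  have h2 : ∫ x, Real.exp (γ * (m - m') / v * x) ∂gaussianReal m' v =
      Real.exp (m' * (γ * (m - m') / v) + v * (γ * (m - m') / v) ^ 2 / 2) := by
    have := congrFun (mgf_id_gaussianReal (μ := m') (v := v)) (γ * (m - m') / v)
    simpa [mgf] using this
  rw [h2, ← Real.exp_add]
  refine ENNReal.ofReal_le_ofReal (Real.exp_le_exp.2 (le_of_eq ?_))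
  field_simp
  ring

/-- If the log-likelihood ratio takes values in an interval of length `b - a`, the divergence of
order `γ` is at most `γ (b - a)² / 8`. Hoeffding's lemma bounds the exponential moments of the
ratio under `P` around its mean, and applied to `E_P exp (-loss) = 1` it bounds that mean. -/
lemma dualRenyiBound_of_logRatio_mem_Icc (hγ : 1 < γ) {P Q : Measure Ω} [IsProbabilityMeasure P]
    [IsProbabilityMeasure Q] {loss : Ω → ℝ} (hm : Measurable loss) {a b : ℝ}
    (hab : ∀ x, loss x ∈ Set.Icc a b)
    (hPQ : ∀ g : Ω → ℝ≥0∞, Measurable g →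
      ∫⁻ x, g x ∂P = ∫⁻ x, ENNReal.ofReal (Real.exp (loss x)) * g x ∂Q) :
    DualRenyiBound γ ((b - a) ^ 2 / 8) P Q := by
  refine dualRenyiBound_of_density hγ (by fun_prop) hPQ ?_
  have hsub := hasSubgaussianMGF_of_mem_Icc (μ := P) hm.aemeasurable (ae_of_all _ hab)
  set mean := ∫ x, loss x ∂P with hmean
  have hint : ∀ t : ℝ, Integrable (fun x => Real.exp (t * loss x)) P := fun t =>
    integrable_exp_mul_of_mem_Icc hm.aemeasurable (ae_of_all _ hab)
  have hmgf : ∀ t : ℝ, ∫ x, Real.exp (t * loss x) ∂P ≤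
      Real.exp (t * mean + t ^ 2 * (b - a) ^ 2 / 8) := by
    intro t
    have h1 := hsub.mgf_le t
    rw [mgf] at h1
    have h2 : ∀ x, Real.exp (t * loss x) =
        Real.exp (t * mean) * Real.exp (t * (loss x - mean)) := by
      intro x
      rw [← Real.exp_add]
      congr 1
      ring
    simp only [h2]
    rw [integral_const_mul, Real.exp_add]
    gcongr
    refine h1.trans_eq ?_
    congr 1
    push_cast
    rw [Real.norm_eq_abs, div_pow, sq_abs]
    ring
  have hone : ∫ x, Real.exp (-1 * loss x) ∂P = 1 := by
    rw [integral_eq_lintegral_of_nonneg_ae (ae_of_all _ fun x => (Real.exp_pos _).le)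
      (by fun_prop), hPQ _ (by fun_prop)]
    have : ∀ x, ENNReal.ofReal (Real.exp (loss x)) *
        ENNReal.ofReal (Real.exp (-1 * loss x)) = 1 := by
      intro x
      rw [← ENNReal.ofReal_mul (Real.exp_pos _).le, ← Real.exp_add]
      simp
    simp only [this]
    simp
  have hmean_le : mean ≤ (b - a) ^ 2 / 8 := by
    have := hmgf (-1)
    rw [hone, Real.one_le_exp_iff] at this
    linarith
  -- One factor of the density is absorbed by passing from `Q` to `P`.
  have hpow : ∀ x, ENNReal.ofReal (Real.exp (loss x)) ^ γ =
      ENNReal.ofReal (Real.exp (loss x)) * ENNReal.ofReal (Real.exp ((γ - 1) * loss x)) := by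
    intro x
    rw [ENNReal.ofReal_rpow_of_pos (Real.exp_pos _), ← ENNReal.ofReal_mul (Real.exp_pos _).le,
      ← Real.exp_mul, ← Real.exp_add]
    congr 2
    ring
  simp only [hpow]
  rw [← hPQ _ (by fun_prop), ← ofReal_integral_eq_lintegral_ofReal (hint _)
    (ae_of_all _ fun x => (Real.exp_pos _).le)]
  refine ENNReal.ofReal_le_ofReal ((hmgf _).trans (Real.exp_le_exp.2 ?_))
  nlinarith [mul_le_mul_of_nonneg_left hmean_le (sub_pos.2 hγ).le]

section ExpMechanism

variable {R : Type*} [Fintype R] [MeasurableSpace R] [DiscreteMeasurableSpace R]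

lemma lintegral_expMechanism (c : ℝ) (score : R → ℝ) (g : R → ℝ≥0∞) :
    ∫⁻ r, g r ∂expMechanism c score =
      ∑ r, ENNReal.ofReal (Real.exp (c * score r) / ∑ r', Real.exp (c * score r')) * g r := by
  simp [expMechanism, lintegral_finsetSum_measure, lintegral_smul_measure]

lemma isProbabilityMeasure_expMechanism [Nonempty R] (c : ℝ) (score : R → ℝ) :
    IsProbabilityMeasure (expMechanism c score) := by
  have hZ : 0 < ∑ r', Real.exp (c * score r') :=
    Finset.sum_pos (fun _ _ => Real.exp_pos _) Finset.univ_nonempty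
  constructor
  rw [← lintegral_one, lintegral_expMechanism]
  simp only [mul_one]
  rw [← ENNReal.ofReal_sum_of_nonneg fun r _ => by positivity, ← Finset.sum_div, div_self hZ.ne',
    ENNReal.ofReal_one]

/-- The exponential mechanism: the log-likelihood ratio is `c` times the difference of the scores
up to a constant, hence lies in an interval of length `2 c δ`. -/
lemma dualRenyiBound_expMechanism [Nonempty R] (hγ : 1 < γ) {c δ : ℝ} (hc : 0 ≤ c)
    {score score' : R → ℝ} (h : ∀ r, |score r - score' r| ≤ δ) :
    DualRenyiBound γ ((2 * c * δ) ^ 2 / 8) (expMechanism c score) (expMechanism c score') := by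
  have := isProbabilityMeasure_expMechanism c score
  have := isProbabilityMeasure_expMechanism c score'
  have hZ : 0 < ∑ r', Real.exp (c * score r') :=
    Finset.sum_pos (fun _ _ => Real.exp_pos _) Finset.univ_nonempty
  have hZ' : 0 < ∑ r', Real.exp (c * score' r') :=
    Finset.sum_pos (fun _ _ => Real.exp_pos _) Finset.univ_nonempty
  set Z := ∑ r', Real.exp (c * score r')
  set Z' := ∑ r', Real.exp (c * score' r')
  have key := dualRenyiBound_of_logRatio_mem_Icc hγ (P := expMechanism c score)
    (Q := expMechanism c score')
    (loss := fun r => c * (score r - score' r) + Real.log (Z' / Z))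
    (a := -(c * δ) + Real.log (Z' / Z)) (b := c * δ + Real.log (Z' / Z))
    (Measurable.of_discrete) ?_ ?_
  · convert key using 1
    ring
  · intro r
    have := abs_le.1 (h r)
    constructor <;> nlinarith [mul_le_mul_of_nonneg_left this.1 hc,
      mul_le_mul_of_nonneg_left this.2 hc]
  · intro g _
    rw [lintegral_expMechanism, lintegral_expMechanism]
    refine Finset.sum_congr rfl fun r _ => ?_
    rw [← mul_assoc, ← ENNReal.ofReal_mul (by positivity), Real.exp_add,
      Real.exp_log (by positivity), mul_sub, Real.exp_sub]
    congr 2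
    change _ / Z = _ / Z' * _
    field_simp

end ExpMechanism

end DualRenyi

section Reconstruction

/-! ### Log-determinants of positive definite matrices -/

lemma abs_apply_le_trace {m : Type*} [Fintype m] {W : Matrix m m ℝ} (hW : W.PosSemidef) (i j : m) :
    |W i j| ≤ W.trace := by
  have hdiag : ∀ k, 0 ≤ W k k ∧ W k k ≤ W.trace := fun k =>
    ⟨hW.diag_nonneg, Finset.single_le_sum (f := fun k => W k k)
      (fun l _ => hW.diag_nonneg) (Finset.mem_univ k)⟩
  have hsymm : W j i = W i j := by simpa using hW.1.apply i j
  -- The principal minor of `i` and `j` gives `W i j ^ 2 ≤ W i i * W j j`.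
  have hdet := (hW.submatrix ![i, j]).det_nonneg
  rw [Matrix.det_fin_two] at hdet
  simp only [Matrix.submatrix_apply, Matrix.cons_val_zero, Matrix.cons_val_one, hsymm] at hdet
  refine abs_le_of_sq_le_sq ?_ ((hdiag i).1.trans (hdiag i).2)
  nlinarith [hdiag i, hdiag j, mul_le_mul (hdiag i).2 (hdiag j).2 (hdiag j).1
    ((hdiag i).1.trans (hdiag i).2)]

section PosDef

variable {m : Type*} [Fintype m] [DecidableEq m]

lemma det_half_one_add_of_isHermitian {M : Matrix m m ℝ} (hM : M.IsHermitian) :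
    ((1 / 2 : ℝ) • (1 + M)).det = ∏ i, (1 + hM.eigenvalues i) / 2 := by
  set U : Matrix m m ℝ := hM.eigenvectorUnitary.1 with hU
  have hUU : U * star U = 1 := Unitary.mul_star_self_of_mem hM.eigenvectorUnitary.2
  have hspec : M = U * Matrix.diagonal hM.eigenvalues * star U := by
    conv_lhs => rw [hM.spectral_theorem, Unitary.conjStarAlgAut_apply]
    rfl
  have hsum : (1 / 2 : ℝ) • (1 + M) =
      U * Matrix.diagonal (fun i => (1 + hM.eigenvalues i) / 2) * star U := by
    have hdiag : Matrix.diagonal (fun i => (1 + hM.eigenvalues i) / 2) =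
        (1 / 2 : ℝ) • (1 + Matrix.diagonal hM.eigenvalues) := by
      rw [← Matrix.diagonal_one, Matrix.diagonal_add, ← Matrix.diagonal_smul]
      congr 1
      ext i
      simp
      ring
    rw [hdiag, Matrix.mul_smul, Matrix.smul_mul, mul_add, add_mul, mul_one, hUU, ← hspec]
  rw [hsum, Matrix.det_mul, Matrix.det_mul, mul_right_comm, ← Matrix.det_mul, hUU, Matrix.det_one,
    one_mul, Matrix.det_diagonal]

lemma eq_one_of_eigenvalues_eq_one {M : Matrix m m ℝ} (hM : M.IsHermitian)
    (h : ∀ i, hM.eigenvalues i = 1) : M = 1 := by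
  rw [hM.spectral_theorem]
  have : (RCLike.ofReal ∘ hM.eigenvalues : m → ℝ) = fun _ => 1 := by
    ext i
    simp [h]
  rw [this, Matrix.diagonal_one, map_one]

/-- Strict midpoint log-concavity of the determinant. After a congruence one of the matrices is the
identity, and the inequality is `λ < ((1 + λ) / 2)²` for the eigenvalues `λ ≠ 1` of the other. -/
lemma det_mul_det_lt_det_half_add_sq {A B : Matrix m m ℝ} (hA : A.PosDef) (hB : B.PosDef)
    (hAB : A ≠ B) : A.det * B.det < ((1 / 2 : ℝ) • (A + B)).det ^ 2 := by
  -- `A = Cᵀ C` and `B = Cᵀ M C`, which reduces the claim to the pair `1`, `M`.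
  obtain ⟨C, hC, hAC⟩ : ∃ C : Matrix m m ℝ, IsUnit C ∧ A = star C * C := by
    open scoped MatrixOrder in
    have hS := CFC.sqrt_mul_sqrt_self A hA.posSemidef.nonneg
    have hS' : star (CFC.sqrt A) = CFC.sqrt A := (CFC.sqrt_nonneg A).isSelfAdjoint
    refine ⟨CFC.sqrt A, ?_, by rw [hS', hS]⟩
    exact isUnit_of_mul_isUnit_left (hS.symm ▸ hA.isUnit)
  have hCdet : IsUnit C.det := (Matrix.isUnit_iff_isUnit_det C).1 hC
  set M := star C⁻¹ * B * C⁻¹ with hMdef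
  have hCi : C⁻¹ * C = 1 := Matrix.nonsing_inv_mul C hCdet
  have hCi' : star C * star C⁻¹ = 1 := by rw [← star_mul, hCi, star_one]
  have hBC : B = star C * M * C := by
    calc B = (star C * star C⁻¹) * B * (C⁻¹ * C) := by rw [hCi, hCi', one_mul, mul_one]
      _ = _ := by simp only [hMdef, mul_assoc]
  have hM : M.PosDef := (Matrix.IsUnit.posDef_star_left_conjugate_iff hC).1 (hBC ▸ hB)
  have hM1 : M ≠ 1 := by
    intro h
    apply hAB
    rw [hBC, h, mul_one, hAC]
  have hsum : (1 / 2 : ℝ) • (A + B) = star C * ((1 / 2 : ℝ) • (1 + M)) * C := by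
    rw [Matrix.mul_smul, Matrix.smul_mul, mul_add, add_mul, mul_one, ← hAC, ← hBC]
  have hlt : M.det < ((1 / 2 : ℝ) • (1 + M)).det ^ 2 := by
    rw [det_half_one_add_of_isHermitian hM.1, hM.1.det_eq_prod_eigenvalues, ← Finset.prod_pow]
    obtain ⟨i, hi⟩ : ∃ i, hM.1.eigenvalues i ≠ 1 := by
      by_contra! h
      exact hM1 (eq_one_of_eigenvalues_eq_one hM.1 h)
    refine Finset.prod_lt_prod (fun j _ => hM.eigenvalues_pos j) (fun j _ => ?_)
      ⟨i, Finset.mem_univ i, ?_⟩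
    · simp only [RCLike.ofReal_real_eq_id, id_eq]
      nlinarith [sq_nonneg (hM.1.eigenvalues j - 1)]
    · simp only [RCLike.ofReal_real_eq_id, id_eq]
      have := sq_pos_of_ne_zero (sub_ne_zero.2 hi)
      nlinarith
  have hdet : (star C).det = C.det := by
    rw [Matrix.star_eq_conjTranspose, Matrix.det_conjTranspose, star_trivial]
  rw [hsum, hBC, hAC]
  simp only [Matrix.det_mul, hdet]
  have h4 : 0 < C.det ^ 4 := by
    have := hCdet.ne_zero
    positivity
  nlinarith [mul_lt_mul_of_pos_left hlt h4]

lemma log_det_le_trace {W : Matrix m m ℝ} (hW : W.PosDef) : Real.log W.det ≤ W.trace := by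
  rw [hW.1.det_eq_prod_eigenvalues, hW.1.trace_eq_sum_eigenvalues]
  simp only [RCLike.ofReal_real_eq_id, id_eq]
  rw [Real.log_prod fun i _ => (hW.eigenvalues_pos i).ne']
  refine Finset.sum_le_sum fun i _ => ?_
  have := Real.log_le_sub_one_of_pos (hW.eigenvalues_pos i)
  linarith

/-- Positive semidefinite matrices with bounded entries and determinant bounded away from zero. -/
def posDefBox (m : Type*) [Fintype m] [DecidableEq m] (r δ : ℝ) : Set (Matrix m m ℝ) :=
  {W | W.PosSemidef ∧ (∀ i j, |W i j| ≤ r) ∧ δ ≤ W.det}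

lemma posDef_of_mem_posDefBox {r δ : ℝ} (hδ : 0 < δ) {W : Matrix m m ℝ}
    (hW : W ∈ posDefBox m r δ) : W.PosDef :=
  hW.1.posDef_iff_det_ne_zero.2 (hδ.trans_le hW.2.2).ne'

lemma isCompact_posDefBox (r δ : ℝ) : IsCompact (posDefBox m r δ) := by
  have hc : IsCompact (Set.univ.pi fun _ : m => Set.univ.pi fun _ : m => Set.Icc (-r) r) :=
    isCompact_univ_pi fun _ => isCompact_univ_pi fun _ => isCompact_Icc
  refine IsCompact.of_isClosed_subset (X := Matrix m m ℝ) hc ?_ ?_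
  · have hpsd : IsClosed {W : Matrix m m ℝ | W.PosSemidef} := by
      simp only [Matrix.posSemidef_iff_dotProduct_mulVec, Set.ofPred_and, Set.ofPred_forall]
      refine (isClosed_eq (by fun_prop) continuous_id).inter (isClosed_iInter fun x => ?_)
      exact isClosed_le continuous_const (by fun_prop)
    have hentry : IsClosed {W : Matrix m m ℝ | ∀ i j, |W i j| ≤ r} := by
      simp only [Set.ofPred_forall]
      exact isClosed_iInter fun i => isClosed_iInter fun j =>
        isClosed_le (by fun_prop) continuous_const
    have hdet : IsClosed {W : Matrix m m ℝ | δ ≤ W.det} :=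
      isClosed_le continuous_const (Continuous.matrix_det continuous_id)
    exact hpsd.inter (hentry.inter hdet)
  · intro W hW i _ j _
    exact abs_le.1 (hW.2.1 i j)

end PosDef

/-! ### Existence, uniqueness and continuity of the barrier minimizer -/

variable {d : ℕ}

/-- The objective `L(W) - μ log |W|`, jointly in the parameters `θ = (y, λ, μ)` and in `W`. -/
def barrierObjective (θ : (Entry d → ℝ) × (Entry d → ℝ) × ℝ) (W : Matrix (Fin d) (Fin d) ℝ) : ℝ :=
  loss θ.1 θ.2.1 W - θ.2.2 * Real.log W.det

/-- The pairs of measurements and precisions for which the reconstruction is defined: all precisions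
are nonnegative and the diagonal ones are positive. -/
def measuredDiag (d : ℕ) : Set ((Entry d → ℝ) × (Entry d → ℝ)) :=
  {p | (∀ e, 0 ≤ p.2 e) ∧ ∀ e : Entry d, e.1.1 = e.1.2 → 0 < p.2 e}

/-- The parameters `(y, λ, μ)` for which the barrier problem is well posed. -/
def barrierDomain (d : ℕ) : Set ((Entry d → ℝ) × (Entry d → ℝ) × ℝ) :=
  {θ | (θ.1, θ.2.1) ∈ measuredDiag d ∧ 0 < θ.2.2}

/-- The diagonal entry `(j, j)`. -/
def diagEntry (j : Fin d) : Entry d := ⟨(j, j), le_refl j⟩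

lemma diagEntry_injective : Function.Injective (diagEntry (d := d)) := fun i j h => by
  simpa [diagEntry] using h

lemma loss_nonneg {y lam : Entry d → ℝ} (h : ∀ e, 0 ≤ lam e) (W : Matrix (Fin d) (Fin d) ℝ) :
    0 ≤ loss y lam W :=
  Finset.sum_nonneg fun e _ => mul_nonneg (h e) (sq_nonneg _)

lemma sum_diag_le_loss {y lam : Entry d → ℝ} (h : ∀ e, 0 ≤ lam e)
    (W : Matrix (Fin d) (Fin d) ℝ) :
    ∑ j, lam (diagEntry j) * (W j j - y (diagEntry j)) ^ 2 ≤ loss y lam W := by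
  have := Finset.sum_map Finset.univ ⟨diagEntry (d := d), diagEntry_injective⟩
    (fun e => lam e * (entryOf W e - y e) ^ 2)
  refine this.symm.trans_le (Finset.sum_le_sum_of_subset_of_nonneg (Finset.subset_univ _)
    fun e _ _ => mul_nonneg (h e) (sq_nonneg _))

lemma loss_half_add_le {y lam : Entry d → ℝ} (h : ∀ e, 0 ≤ lam e)
    (V W : Matrix (Fin d) (Fin d) ℝ) :
    2 * loss y lam ((1 / 2 : ℝ) • (V + W)) ≤ loss y lam V + loss y lam W := by
  simp only [loss, Finset.mul_sum, ← Finset.sum_add_distrib]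
  refine Finset.sum_le_sum fun e _ => ?_
  simp only [entryOf, Matrix.smul_apply, Matrix.add_apply, smul_eq_mul]
  nlinarith [mul_nonneg (h e) (sq_nonneg (V e.1.1 e.1.2 - W e.1.1 e.1.2))]

lemma IsBarrierMin.eq {y lam : Entry d → ℝ} (h : ∀ e, 0 ≤ lam e) {μ : ℝ} (hμ : 0 < μ)
    {V W : Matrix (Fin d) (Fin d) ℝ} (hV : IsBarrierMin y lam μ V)
    (hW : IsBarrierMin y lam μ W) : V = W := by
  by_contra hne
  have hmid : ((1 / 2 : ℝ) • (V + W)).PosDef := (hV.1.add hW.1).smul (by norm_num)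
  have hlog : Real.log V.det + Real.log W.det < 2 * Real.log ((1 / 2 : ℝ) • (V + W)).det := by
    rw [← Real.log_mul hV.1.det_pos.ne' hW.1.det_pos.ne']
    have := Real.log_lt_log (mul_pos hV.1.det_pos hW.1.det_pos)
      (det_mul_det_lt_det_half_add_sq hV.1 hW.1 hne)
    rwa [Real.log_pow] at this
  have h1 := hV.2 _ hmid
  have h2 := hW.2 _ hmid
  have h3 := loss_half_add_le (y := y) h V W
  nlinarith [mul_lt_mul_of_pos_left hlog hμ]

/-- Coercivity, locally uniformly in the parameters: sublevel sets of the objective lie in one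
compact set of positive definite matrices. The quadratic loss of the diagonal entries dominates
`μ log |W| ≤ μ tr W`, which bounds the trace; then `log |W|` is bounded below. -/
lemma exists_posDefBox_of_barrierObjective_le {θ₀ : (Entry d → ℝ) × (Entry d → ℝ) × ℝ}
    (hθ₀ : θ₀ ∈ barrierDomain d) (c : ℝ) :
    ∃ r δ : ℝ, 0 < δ ∧ ∀ᶠ θ in 𝓝[barrierDomain d] θ₀, ∀ W : Matrix (Fin d) (Fin d) ℝ,
      W.PosDef → barrierObjective θ W ≤ c → W ∈ posDefBox (Fin d) r δ := by
  obtain ⟨a, ha, ha0⟩ : ∃ a : ℝ, (∀ j : Fin d, a < θ₀.2.1 (diagEntry j)) ∧ 0 < a := by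
    have h1 : ∀ᶠ a in 𝓝[>] (0 : ℝ), ∀ j : Fin d, a < θ₀.2.1 (diagEntry j) :=
      eventually_all.2 fun j =>
        mem_nhdsWithin_of_mem_nhds (Iio_mem_nhds (hθ₀.1.2 (diagEntry j) rfl))
    exact (h1.and self_mem_nhdsWithin).exists
  -- `R` bounds the diagonal of `y`, `M` bounds `μ`, and `C` comes from completing the square in
  -- `a (x - y)² - M x ≥ x - C`.
  set R : ℝ := ∑ j : Fin d, |θ₀.1 (diagEntry j)| + 1 with hR
  set M : ℝ := 2 * θ₀.2.2 with hM
  set C : ℝ := (2 * a * R + M + 1) ^ 2 / (4 * a) with hC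
  have hμ₀ := hθ₀.2
  refine ⟨c + d * C, Real.exp (-(|c| / (θ₀.2.2 / 2))), Real.exp_pos _, ?_⟩
  have ev1 : ∀ᶠ θ in 𝓝[barrierDomain d] θ₀, ∀ j : Fin d, a < θ.2.1 (diagEntry j) := by
    refine eventually_all.2 fun j => eventually_nhdsWithin_of_eventually_nhds ?_
    exact (Continuous.tendsto (by fun_prop) θ₀ : Tendsto
      (fun θ : (Entry d → ℝ) × (Entry d → ℝ) × ℝ => θ.2.1 (diagEntry j)) _ _).eventually_const_lt
        (ha j)
  have ev2 : ∀ᶠ θ in 𝓝[barrierDomain d] θ₀, ∀ j : Fin d, |θ.1 (diagEntry j)| < R := by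
    refine eventually_all.2 fun j => eventually_nhdsWithin_of_eventually_nhds ?_
    refine (Continuous.tendsto (by fun_prop) θ₀ : Tendsto
      (fun θ : (Entry d → ℝ) × (Entry d → ℝ) × ℝ => |θ.1 (diagEntry j)|) _ _).eventually_lt_const ?_
    have := Finset.single_le_sum (f := fun j : Fin d => |θ₀.1 (diagEntry j)|)
      (fun _ _ => abs_nonneg _) (Finset.mem_univ j)
    linarith
  have ev3 : ∀ᶠ θ in 𝓝[barrierDomain d] θ₀, θ₀.2.2 / 2 < θ.2.2 ∧ θ.2.2 < M := by
    refine eventually_nhdsWithin_of_eventually_nhds ?_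
    have ht : Tendsto (fun θ : (Entry d → ℝ) × (Entry d → ℝ) × ℝ => θ.2.2) (𝓝 θ₀) (𝓝 θ₀.2.2) :=
      Continuous.tendsto (by fun_prop) θ₀
    exact (ht.eventually_const_lt (by linarith)).and (ht.eventually_lt_const (by linarith))
  filter_upwards [ev1, ev2, ev3, self_mem_nhdsWithin] with θ h1 h2 h3 hθ W hW hle
  have hloss := sum_diag_le_loss (y := θ.1) hθ.1.1 W
  have hloss0 := loss_nonneg (y := θ.1) hθ.1.1 W
  rw [barrierObjective] at hle
  have htrace : W.trace ≤ c + d * C := by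
    have hlog : θ.2.2 * Real.log W.det ≤ M * W.trace :=
      (mul_le_mul_of_nonneg_left (log_det_le_trace hW) hθ.2.le).trans
        (mul_le_mul_of_nonneg_right h3.2.le hW.posSemidef.trace_nonneg)
    have hterm : ∀ j : Fin d, (M + 1) * W j j - C ≤
        θ.2.1 (diagEntry j) * (W j j - θ.1 (diagEntry j)) ^ 2 := by
      intro j
      have hx : 0 < W j j := hW.diag_pos
      have hy := (abs_lt.1 (h2 j)).2
      have hCq : (2 * a * R + M + 1) * W j j ≤ a * W j j ^ 2 + C := by
        have h4 : a * W j j ^ 2 + C - (2 * a * R + M + 1) * W j j =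
            (2 * a * W j j - (2 * a * R + M + 1)) ^ 2 / (4 * a) := by
          rw [hC]
          field_simp
          ring
        have h5 : 0 ≤ (2 * a * W j j - (2 * a * R + M + 1)) ^ 2 / (4 * a) := by positivity
        linarith
      have h6 : a * (W j j - θ.1 (diagEntry j)) ^ 2 ≤
          θ.2.1 (diagEntry j) * (W j j - θ.1 (diagEntry j)) ^ 2 :=
        mul_le_mul_of_nonneg_right (h1 j).le (sq_nonneg _)
      have h7 : a * (W j j * θ.1 (diagEntry j)) ≤ a * (W j j * R) := by gcongr
      nlinarith [mul_nonneg ha0.le (sq_nonneg (θ.1 (diagEntry j)))]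
    have hsum := Finset.sum_le_sum fun j (_ : j ∈ (Finset.univ : Finset (Fin d))) => hterm j
    rw [Finset.sum_sub_distrib, ← Finset.mul_sum] at hsum
    simp only [Finset.sum_const, Finset.card_univ, Fintype.card_fin, nsmul_eq_mul] at hsum
    change (M + 1) * W.trace - _ ≤ _ at hsum
    linarith
  refine ⟨hW.posSemidef, fun i j => (abs_apply_le_trace hW.posSemidef i j).trans htrace, ?_⟩
  rw [← Real.le_log_iff_exp_le hW.det_pos]
  have hlow : -|c| ≤ θ.2.2 * Real.log W.det := by linarith [le_abs_self c]
  rw [neg_le, div_eq_mul_inv]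
  by_contra! hcon
  rw [← div_eq_mul_inv, div_lt_iff₀ (by linarith)] at hcon
  nlinarith [abs_nonneg c, hθ.2]

lemma continuousAt_barrierObjective {θ : (Entry d → ℝ) × (Entry d → ℝ) × ℝ}
    {W : Matrix (Fin d) (Fin d) ℝ} (hW : W.PosDef) :
    ContinuousAt (Function.uncurry (barrierObjective (d := d))) (θ, W) := by
  unfold barrierObjective loss entryOf Function.uncurry
  have h1 : ContinuousAt (fun x : ((Entry d → ℝ) × (Entry d → ℝ) × ℝ) ×
      Matrix (Fin d) (Fin d) ℝ => Real.log x.2.det) (θ, W) :=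
    ContinuousAt.log (Continuous.continuousAt (by fun_prop)) hW.det_pos.ne'
  exact ContinuousAt.sub (Continuous.continuousAt (by fun_prop))
    (ContinuousAt.mul (Continuous.continuousAt (by fun_prop)) h1)

lemma isBarrierMin_barrierMinimizer {θ : (Entry d → ℝ) × (Entry d → ℝ) × ℝ}
    (hθ : θ ∈ barrierDomain d) :
    IsBarrierMin θ.1 θ.2.1 θ.2.2 (barrierMinimizer θ.1 θ.2.1 θ.2.2) := by
  refine Classical.epsilon_spec (p := IsBarrierMin θ.1 θ.2.1 θ.2.2) ?_
  obtain ⟨r, δ, hδ, hev⟩ := exists_posDefBox_of_barrierObjective_le hθ (barrierObjective θ 1)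
  have hbox := hev.self_of_nhdsWithin hθ
  have hcont : ContinuousOn (barrierObjective θ) (posDefBox (Fin d) r δ) := fun W hW =>
    ((continuousAt_barrierObjective (posDef_of_mem_posDefBox hδ hW)).comp
      (f := fun W => (θ, W)) (by fun_prop)).continuousWithinAt
  obtain ⟨W, hW, hmin⟩ := (isCompact_posDefBox r δ).exists_isMinOn
    ⟨1, hbox 1 Matrix.PosDef.one le_rfl⟩ hcont
  refine ⟨W, posDef_of_mem_posDefBox hδ hW, fun V hV => ?_⟩
  rcases le_total (barrierObjective θ V) (barrierObjective θ 1) with h | h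
  · exact hmin (hbox V hV h)
  · exact (hmin (hbox 1 Matrix.PosDef.one le_rfl)).trans h

/-- The barrier minimizer depends continuously on all parameters: it stays in a compact set, and
every cluster point of minimizers is a minimizer, hence the unique one. -/
lemma continuousOn_barrierMinimizer :
    ContinuousOn (fun θ : (Entry d → ℝ) × (Entry d → ℝ) × ℝ =>
      barrierMinimizer θ.1 θ.2.1 θ.2.2) (barrierDomain d) := by
  intro θ₀ hθ₀
  obtain ⟨r, δ, hδ, hev⟩ :=
    exists_posDefBox_of_barrierObjective_le hθ₀ (barrierObjective θ₀ 1 + 1)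
  have hobj : ∀ V : Matrix (Fin d) (Fin d) ℝ, V.PosDef →
      Tendsto (fun θ => barrierObjective θ V) (𝓝 θ₀) (𝓝 (barrierObjective θ₀ V)) := fun V hV =>
    ((continuousAt_barrierObjective (θ := θ₀) hV).comp (f := fun θ => (θ, V)) (by fun_prop))
  refine (isCompact_posDefBox (m := Fin d) r δ).tendsto_nhds_of_unique_mapClusterPt ?_ ?_
  · filter_upwards [hev, self_mem_nhdsWithin, mem_nhdsWithin_of_mem_nhds
      ((hobj 1 Matrix.PosDef.one).eventually_lt_const (lt_add_one _))] with θ h1 h2 h3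
    have hmin := isBarrierMin_barrierMinimizer h2
    exact h1 _ hmin.1 ((hmin.2 1 Matrix.PosDef.one).trans (le_of_lt h3))
  · intro W hW hcl
    have hWpd := posDef_of_mem_posDefBox hδ hW
    refine IsBarrierMin.eq (y := θ₀.1) hθ₀.1.1 hθ₀.2 ⟨hWpd, fun V hV => ?_⟩
      (isBarrierMin_barrierMinimizer hθ₀)
    obtain ⟨U, hU, hUt⟩ := mapClusterPt_iff_ultrafilter.1 hcl
    have hU₀ : Tendsto (fun θ => θ) (U : Filter ((Entry d → ℝ) × (Entry d → ℝ) × ℝ)) (𝓝 θ₀) :=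
      hU.trans nhdsWithin_le_nhds
    have hpair : Tendsto (fun θ => (θ, barrierMinimizer θ.1 θ.2.1 θ.2.2))
        (U : Filter ((Entry d → ℝ) × (Entry d → ℝ) × ℝ)) (𝓝 (θ₀, W)) := hU₀.prodMk_nhds hUt
    have hcont : Tendsto (Function.uncurry (barrierObjective (d := d))) (𝓝 (θ₀, W))
        (𝓝 (barrierObjective θ₀ W)) := continuousAt_barrierObjective hWpd
    have hlim := hcont.comp hpair
    refine le_of_tendsto_of_tendsto hlim ((hobj V hV).comp hU₀) ?_
    filter_upwards [hU self_mem_nhdsWithin] with θ hθ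
    exact (isBarrierMin_barrierMinimizer hθ).2 V hV

/-! ### Measurability of the reconstruction -/

/-- Along a function that is continuous on `(0, ∞)`, the limit at `0+` may be taken over the
positive rationals; this includes the case that there is no limit. -/
lemma limUnder_nhdsGT_eq_limUnder_rat {E : Type*} [TopologicalSpace E] [RegularSpace E]
    [Nonempty E] {f : ℝ → E} (hf : ContinuousOn f (Set.Ioi 0)) :
    limUnder (𝓝[>] (0 : ℝ)) f =
      limUnder (comap (fun q : {q : ℚ // 0 < q} => ((q : ℚ) : ℝ)) (𝓝[>] 0))
        (fun q => f (q : ℚ)) := by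
  unfold limUnder lim
  congr 1
  funext x
  refine propext ⟨fun h => Tendsto.comp (g := f) h tendsto_comap, fun h => ?_⟩
  refine (closed_nhds_basis x).ge_iff.2 fun V hV => ?_
  obtain ⟨S, hS, hSV⟩ := h hV.1
  obtain ⟨u, hu, huS⟩ := mem_nhdsGT_iff_exists_Ioo_subset.1 hS
  refine mem_map.2 (mem_of_superset (Ioo_mem_nhdsGT hu) fun t ht => ?_)
  have hcl : t ∈ closure (Set.Ioo 0 u ∩ Set.range ((↑) : ℚ → ℝ)) :=
    Dense.open_subset_closure_inter Rat.denseRange_cast isOpen_Ioo ht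
  have hmaps : Set.MapsTo f (Set.Ioo 0 u ∩ Set.range ((↑) : ℚ → ℝ)) V := by
    rintro _ ⟨hq, q, rfl⟩
    exact hSV (show (⟨q, by exact_mod_cast hq.1⟩ : {q : ℚ // 0 < q}) ∈ _ from huS hq)
  have := ((hf t ht.1).mono fun s hs => hs.1.1).mem_closure hcl hmaps
  rwa [hV.2.closure_eq] at this

instance (d : ℕ) : PolishSpace (Matrix (Fin d) (Fin d) ℝ) :=
  inferInstanceAs (PolishSpace (Fin d → Fin d → ℝ))

instance (d : ℕ) : BorelSpace (Matrix (Fin d) (Fin d) ℝ) :=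
  inferInstanceAs (BorelSpace (Fin d → Fin d → ℝ))

lemma measurableSet_measuredDiag : MeasurableSet (measuredDiag d) := by
  simp only [measuredDiag, Set.ofPred_and, Set.ofPred_forall]
  refine (MeasurableSet.iInter fun e => measurableSet_le measurable_const (by fun_prop)).inter
    (MeasurableSet.iInter fun e => MeasurableSet.iInter fun _ =>
      measurableSet_lt measurable_const (by fun_prop))

lemma measurable_maxEntReconstruction :
    Measurable fun p : (Entry d → ℝ) × (Entry d → ℝ) => maxEntReconstruction p.1 p.2 := by
  classical
  refine measurable_of_restrict_of_restrict_compl measurableSet_measuredDiag ?_ ?_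
  · have heq : (measuredDiag d).domRestrict (fun p => maxEntReconstruction p.1 p.2) = fun p =>
        limUnder (comap (fun q : {q : ℚ // 0 < q} => ((q : ℚ) : ℝ)) (𝓝[>] 0))
          (fun q => barrierMinimizer p.1.1 p.1.2 (q : ℚ)) := by
      funext p
      refine (if_pos p.2).trans ?_
      refine limUnder_nhdsGT_eq_limUnder_rat (f := fun μ => barrierMinimizer p.1.1 p.1.2 μ) ?_
      exact continuousOn_barrierMinimizer.comp (f := fun μ : ℝ => (p.1.1, p.1.2, μ))
        (by fun_prop) fun μ hμ => ⟨p.2, hμ⟩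
    rw [heq]
    refine (StronglyMeasurable.limUnder fun q => ?_).measurable
    refine Continuous.stronglyMeasurable ?_
    exact continuousOn_barrierMinimizer.comp_continuous
      (f := fun p : measuredDiag d => (p.1.1, p.1.2, ((q : ℚ) : ℝ))) (by fun_prop)
      fun p => ⟨p.2, Rat.cast_pos.2 q.2⟩
  · have heq : (measuredDiag d)ᶜ.domRestrict (fun p => maxEntReconstruction p.1 p.2) =
        fun _ => 0 := by
      funext p
      exact if_neg p.2
    rw [heq]
    exact measurable_const

end Reconstruction

/-! ### Sensitivity -/

lemma secondMoment_apply {n d : ℕ} {B : ℝ} (X : Dataset n d B) (j k : Fin d) :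
    secondMoment X j k = (n : ℝ)⁻¹ * ∑ i, (X i).1 j * (X i).1 k := by
  simp [secondMoment, Matrix.mul_apply, dataMatrix]

lemma abs_secondMoment_sub_le {n d : ℕ} {B : ℝ} {X X' : Dataset n d B}
    (h : Neighboring X X') (j k : Fin d) :
    |secondMoment X j k - secondMoment X' j k| ≤ 2 * B ^ 2 / n := by
  obtain ⟨i, -, hi⟩ := h
  have hprod : ∀ x : Record d B, |x.1 j * x.1 k| ≤ B ^ 2 := by
    intro x
    rw [abs_mul, sq]
    exact mul_le_mul (x.2 j) (x.2 k) (abs_nonneg _) ((abs_nonneg _).trans (x.2 j))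
  -- Only the term of the differing record survives in the difference.
  rw [secondMoment_apply, secondMoment_apply, ← mul_sub, ← Finset.sum_sub_distrib,
    Finset.sum_eq_single_of_mem i (Finset.mem_univ i) fun l _ hl => by rw [hi l hl, sub_self],
    abs_mul, abs_inv, Nat.abs_cast, inv_mul_eq_div]
  gcongr
  refine (abs_sub _ _).trans ?_
  linarith [hprod (X i), hprod (X' i)]

/-! ### Random while loops -/

lemma bind_map {Ω₁ Ω₂ Ω₃ : Type*} [MeasurableSpace Ω₁] [MeasurableSpace Ω₂] [MeasurableSpace Ω₃]
    (μ : Measure Ω₁) {f : Ω₁ → Ω₂} (hf : Measurable f) {κ : Ω₂ → Measure Ω₃} (hκ : Measurable κ) :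
    (μ.map f).bind κ = μ.bind fun a => κ (f a) := by
  rw [Measure.bind, Measure.map_map hκ hf]
  rfl

section WhileLoop

variable {S : Type*} [MeasurableSpace S] {guard : S → Prop} {body : S → Measure S}

lemma measurable_haltsAfter (hg : MeasurableSet {s | guard s}) (hb : Measurable body) (k : ℕ) :
    Measurable (haltsAfter guard body k) := by
  classical
  induction k with
  | zero =>
    have : haltsAfter guard body 0 = fun s => if guard s then 0 else Measure.dirac s := by
      funext s
      simp [haltsAfter]
    rw [this]
    exact Measurable.ite hg measurable_const Measure.measurable_dirac
  | succ k ih =>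
    have : haltsAfter guard body (k + 1) =
        fun s => if guard s then (body s).bind (haltsAfter guard body k) else 0 := by
      funext s
      simp [haltsAfter]
    rw [this]
    exact Measurable.ite hg ((Measure.measurable_bind' ih).comp hb) measurable_const

lemma measurable_whileLaw (hg : MeasurableSet {s | guard s}) (hb : Measurable body) :
    Measurable (whileLaw guard body) := by
  refine Measure.measurable_of_measurable_coe _ fun A hA => ?_
  simp only [whileLaw, Measure.sum_apply _ hA]
  exact Measurable.tsum fun k =>
    (Measure.measurable_coe hA).comp (measurable_haltsAfter hg hb k)

lemma whileLaw_of_not {s : S} (hs : ¬ guard s) : whileLaw guard body s = Measure.dirac s := by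
  ext A hA
  rw [whileLaw, Measure.sum_apply _ hA, tsum_eq_single 0]
  · simp [haltsAfter, hs]
  · intro k hk
    obtain ⟨k, rfl⟩ := Nat.exists_eq_succ_of_ne_zero hk
    simp [haltsAfter, hs]

lemma whileLaw_of_guard (hg : MeasurableSet {s | guard s}) (hb : Measurable body) {s : S}
    (hs : guard s) : whileLaw guard body s = (body s).bind (whileLaw guard body) := by
  ext A hA
  rw [Measure.bind_apply hA (measurable_whileLaw hg hb).aemeasurable]
  simp only [whileLaw, Measure.sum_apply _ hA]
  have hmeas : ∀ k, AEMeasurable (fun s => haltsAfter guard body k s A) (body s) := fun k =>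
    ((Measure.measurable_coe hA).comp (measurable_haltsAfter hg hb k)).aemeasurable
  rw [lintegral_tsum hmeas, tsum_eq_zero_add' ENNReal.summable]
  simp [haltsAfter, hs, Measure.bind_apply hA (measurable_haltsAfter hg hb _).aemeasurable]

end WhileLoop

/-! ### Measurability of a round -/

variable {n d : ℕ}

lemma measurable_state_iff {α : Type*} [MeasurableSpace α] {f : α → State d} :
    Measurable f ↔ Measurable (fun a => (f a).toTuple) :=
  measurable_comap_iff

lemma measurable_toTuple : Measurable (State.toTuple (d := d)) := comap_measurable _

@[fun_prop] lemma measurable_state_y : Measurable (State.y (d := d)) := measurable_toTuple.fst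

@[fun_prop] lemma measurable_state_lam : Measurable (State.lam (d := d)) :=
  measurable_toTuple.snd.fst

@[fun_prop] lemma measurable_state_est : Measurable (State.est (d := d)) :=
  measurable_toTuple.snd.snd.fst

@[fun_prop] lemma measurable_state_used : Measurable (State.used (d := d)) :=
  measurable_toTuple.snd.snd.snd.fst

@[fun_prop] lemma measurable_state_sel : Measurable (State.sel (d := d)) :=
  measurable_toTuple.snd.snd.snd.snd.fst

@[fun_prop] lemma measurable_state_meas : Measurable (State.meas (d := d)) :=
  measurable_toTuple.snd.snd.snd.snd.snd

@[fun_prop] lemma measurable_entryOf (e : Entry d) : Measurable fun W => entryOf W e :=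
  (measurable_pi_apply e.1.2).comp (measurable_pi_apply (X := fun _ => Fin d → ℝ) e.1.1)

@[fun_prop] lemma measurable_measVar (P : Params) : Measurable (measVar n (d := d) P) := by
  unfold measVar
  fun_prop

lemma measurable_update_const {α : Type*} [MeasurableSpace α] {ι : Type*} [DecidableEq ι]
    {f : α → ι → ℝ} {g : α → ℝ} (hf : Measurable f) (hg : Measurable g) (e : ι) :
    Measurable fun a => Function.update (f a) e (g a) := by
  refine measurable_pi_lambda _ fun i => ?_
  by_cases h : i = e
  · subst h
    simpa using hg
  · simpa [h] using measurable_pi_iff.1 hf i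

lemma measurable_anneal (P : Params) : Measurable fun p : ℝ × ℝ × ℝ × ℝ × ℝ =>
    anneal P p.1 p.2.1 p.2.2.1 p.2.2.2.1 p.2.2.2.2 := by
  classical
  have hb : Measurable fun p : ℝ × ℝ × ℝ × ℝ × ℝ =>
      if p.1 ≤ Real.sqrt (2 / Real.pi) * Real.sqrt p.2.1 then
        (2 * p.2.2.2.1, 4 * p.2.2.2.2) else (p.2.2.2.1, p.2.2.2.2) :=
    Measurable.ite (measurableSet_le (by fun_prop) (by fun_prop)) (by fun_prop) (by fun_prop)
  exact Measurable.ite (measurableSet_lt (by fun_prop)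
    ((hb.fst.add hb.snd).const_mul 2)) (by fun_prop) hb

lemma measurable_updateState (P : Params) (e : Entry d) :
    Measurable fun p : State d × ℝ => updateState n P p.1 e p.2 := by
  rw [measurable_state_iff]
  have hy : Measurable fun p : State d × ℝ => Function.update p.1.y e
      ((p.1.lam e * p.1.y e + (measVar n P p.1)⁻¹ * p.2) / (p.1.lam e + (measVar n P p.1)⁻¹)) :=
    measurable_update_const (by fun_prop) (by fun_prop) e
  have hlam : Measurable fun p : State d × ℝ =>
      Function.update p.1.lam e (p.1.lam e + (measVar n P p.1)⁻¹) :=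
    measurable_update_const (by fun_prop) (by fun_prop) e
  have hest := measurable_maxEntReconstruction.comp (hy.prodMk hlam)
  have hchange : Measurable fun p : State d × ℝ =>
      |entryOf (updateState n P p.1 e p.2).est e - entryOf p.1.est e| :=
    (((measurable_entryOf e).comp hest).sub (by fun_prop)).abs
  have hused : Measurable fun p : State d × ℝ => p.1.used + p.1.sel + p.1.meas := by fun_prop
  have hanneal := (measurable_anneal P).comp (hchange.prodMk (Measurable.prodMk
    (f := fun p : State d × ℝ => measVar n P p.1) (by fun_prop) (hused.prodMk (Measurable.prodMk
    (f := fun p : State d × ℝ => p.1.sel) (g := fun p => p.1.meas) (by fun_prop) (by fun_prop)))))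
  exact hy.prodMk (hlam.prodMk (hest.prodMk (hused.prodMk (hanneal.fst.prodMk hanneal.snd))))

lemma measurable_updateState_right (P : Params) (s : State d) (e : Entry d) :
    Measurable (updateState n P s e) :=
  (measurable_updateState P e).comp measurable_prodMk_left

lemma measurable_initState (P : Params) : Measurable (initState n (d := d) P) := by
  rw [measurable_state_iff]
  have hy : Measurable fun v : Fin d → ℝ =>
      fun e : Entry d => if e.1.1 = e.1.2 then v e.1.1 else 0 := by
    refine measurable_pi_lambda _ fun e => ?_
    by_cases h : e.1.1 = e.1.2
    · simpa [h] using measurable_pi_apply _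
    · simp [h]
  have hest : Measurable fun v : Fin d → ℝ => Matrix.diagonal fun j => max (v j) 0 := by
    refine measurable_pi_lambda _ fun i => measurable_pi_lambda _ fun j => ?_
    by_cases h : i = j
    · subst h
      simp only [Matrix.diagonal_apply_eq]
      fun_prop
    · simp [Matrix.diagonal_apply_ne _ h]
  exact hy.prodMk ((measurable_const (a := (initState n P 0).lam)).prodMk (hest.prodMk
    (measurable_const (a := (P.α * P.ρ, P.β * P.perRound, (1 - P.β) * P.perRound)))))

section Round

variable {P : Params} (X : Dataset n d P.B)

/-- The law of a round is a finite mixture over the entries; both the weights and the noise level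
of the mixed laws depend measurably on the state. -/
lemma measurable_roundLaw : Measurable (roundLaw P X) := by
  refine Measure.measurable_of_measurable_coe _ fun A hA => ?_
  have hmeasure : ∀ e : Entry d, Measurable fun s : State d =>
      ((gaussianReal (entryOf (secondMoment X) e) (measVar n P s).toNNReal).map
        (updateState n P s e)) A := by
    intro e
    let κ : Kernel (State d) ℝ :=
      ⟨fun s => gaussianReal (entryOf (secondMoment X) e) (measVar n P s).toNNReal,
        measurable_gaussianReal.comp (f := fun s : State d =>
          (entryOf (secondMoment X) e, (measVar n P s).toNNReal)) (by fun_prop)⟩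
    have : IsMarkovKernel κ := ⟨fun s => by change IsProbabilityMeasure (gaussianReal _ _)
                                            infer_instance⟩
    have h := Kernel.measurable_kernel_prodMk_left (κ := κ)
      (measurable_updateState (n := n) P e hA)
    convert h using 2 with s
    exact Measure.map_apply (measurable_updateState_right P s e) hA
  have hform : ∀ s : State d, roundLaw P X s A = ∑ e, ENNReal.ofReal
      (Real.exp (Real.sqrt (8 * s.sel) / (2 * P.sens n) *
          |entryOf (secondMoment X) e - entryOf s.est e|) /
        ∑ e', Real.exp (Real.sqrt (8 * s.sel) / (2 * P.sens n) *
          |entryOf (secondMoment X) e' - entryOf s.est e'|)) *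
      ((gaussianReal (entryOf (secondMoment X) e) (measVar n P s).toNNReal).map
        (updateState n P s e)) A := by
    intro s
    rw [roundLaw, Measure.bind_apply hA Measurable.of_discrete.aemeasurable, selectLaw,
      lintegral_expMechanism]
  simp only [hform]
  refine Finset.measurable_sum _ fun e _ => Measurable.mul ?_ (hmeasure e)
  fun_prop

lemma roundLaw_bind (s : State d) {κ : State d → Measure (State d)} (hκ : Measurable κ) :
    (roundLaw P X s).bind κ = (selectLaw P X s).bind fun e =>
      (gaussianReal (entryOf (secondMoment X) e) (measVar n P s).toNNReal).bind fun z =>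
        κ (updateState n P s e z) := by
  rw [roundLaw, Measure.bind_bind Measurable.of_discrete.aemeasurable hκ.aemeasurable]
  congr 1
  funext e
  exact bind_map _ (measurable_updateState_right P s e) hκ

/-- The loop of the algorithm. -/
def loopLaw (s : State d) : Measure (State d) :=
  whileLaw (fun s : State d => s.used < P.ρ) (roundLaw P X) s

lemma measurableSet_guard : MeasurableSet {s : State d | s.used < P.ρ} :=
  measurableSet_lt (by fun_prop) measurable_const

lemma measurable_loopLaw : Measurable (loopLaw X) :=
  measurable_whileLaw measurableSet_guard (measurable_roundLaw X)

lemma loopLaw_of_le {s : State d} (hs : P.ρ ≤ s.used) : loopLaw X s = Measure.dirac s :=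
  whileLaw_of_not hs.not_gt

lemma loopLaw_of_lt {s : State d} (hs : s.used < P.ρ) :
    loopLaw X s = (selectLaw P X s).bind fun e =>
      (gaussianReal (entryOf (secondMoment X) e) (measVar n P s).toNNReal).bind fun z =>
        loopLaw X (updateState n P s e z) :=
  (whileLaw_of_guard measurableSet_guard (measurable_roundLaw X) hs).trans
    (roundLaw_bind X s (measurable_loopLaw X))

end Round

/-! ### Budget accounting and termination -/

/-- The invariant at the head of the loop: the budget is not exceeded, and while budget is left, the
next round has positive budgets, does not exceed the total, and either costs at least the initial
budget of a round or exhausts the total. -/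
structure LoopInv (P : Params) (s : State d) : Prop where
  used_le : s.used ≤ P.ρ
  sel_pos : s.used < P.ρ → 0 < s.sel
  meas_pos : s.used < P.ρ → 0 < s.meas
  next_le : s.used < P.ρ → s.used + s.sel + s.meas ≤ P.ρ
  progress : s.used < P.ρ → P.perRound ≤ s.sel + s.meas ∨ s.used + s.sel + s.meas = P.ρ

lemma LoopInv.updateState {P : Params} (hβ : 0 < P.β ∧ P.β < 1) {s : State d}
    (h : LoopInv P s) (hs : s.used < P.ρ) (e : Entry d) (z : ℝ) :
    LoopInv P (updateState n P s e z) := by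
  classical
  have h1 := h.sel_pos hs
  have h2 := h.meas_pos hs
  have hbudget : ∀ change var : ℝ, ∀ b : ℝ × ℝ,
      b = anneal P change var (s.used + s.sel + s.meas) s.sel s.meas →
      s.used + s.sel + s.meas < P.ρ → 0 < b.1 ∧ 0 < b.2 ∧
        s.used + s.sel + s.meas + b.1 + b.2 ≤ P.ρ ∧
        (P.perRound ≤ b.1 + b.2 ∨ s.used + s.sel + s.meas + b.1 + b.2 = P.ρ) := by
    intro change var b hb hlt
    -- Budget is left after the round, so the round did not exhaust the total.
    have h3 : P.perRound ≤ s.sel + s.meas := (h.progress hs).resolve_right hlt.ne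
    have h4 : 0 < P.ρ - (s.used + s.sel + s.meas) := sub_pos.2 hlt
    have h5 := mul_pos hβ.1 h4
    have h6 := mul_pos (sub_pos.2 hβ.2) h4
    simp only [anneal] at hb
    split_ifs at hb <;> subst hb <;> dsimp only at * <;>
      refine ⟨by linarith, by linarith, by linarith, ?_⟩ <;>
      first
      | exact Or.inr (by linarith)
      | exact Or.inl (by linarith)
  have hb := hbudget |entryOf (PaceGGM.updateState n P s e z).est e - entryOf s.est e|
    (measVar n P s) _ rfl
  exact ⟨h.next_le hs, fun hlt => (hb hlt).1, fun hlt => (hb hlt).2.1, fun hlt => (hb hlt).2.2.1,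
    fun hlt => (hb hlt).2.2.2⟩

lemma Params.perRound_pos {P : Params} (hT : 1 ≤ P.T) (hρ : 0 < P.ρ) (hα : P.α < 1) :
    0 < P.perRound := by
  have hT' : (0 : ℝ) < P.T := by exact_mod_cast hT
  have : 0 < P.ρ - P.α * P.ρ := by nlinarith
  exact div_pos this hT'

lemma loopInv_initState {P : Params} (hT : 1 ≤ P.T) (hρ : 0 < P.ρ) (hα : P.α < 1)
    (hβ : 0 < P.β ∧ P.β < 1) (v : Fin d → ℝ) : LoopInv P (initState n P v) := by
  have hT' : (1 : ℝ) ≤ P.T := by exact_mod_cast hT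
  have hpos := Params.perRound_pos hT hρ hα
  have hrem : P.perRound * P.T = P.ρ - P.α * P.ρ := by
    rw [Params.perRound]
    field_simp
  have hle : P.perRound ≤ P.ρ - P.α * P.ρ := by nlinarith
  constructor <;> simp only [initState]
  · linarith
  · exact fun _ => mul_pos hβ.1 hpos
  · exact fun _ => mul_pos (sub_pos.2 hβ.2) hpos
  · intro
    linarith
  · exact fun _ => Or.inl (by linarith)

/-- Induction over the rounds of the loop. Each round uses at least the initial budget of a round or
exhausts the total, so that there are boundedly many. -/
lemma LoopInv.induction {P : Params} (hc : 0 < P.perRound) (hβ : 0 < P.β ∧ P.β < 1)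
    {p : State d → Prop} (hdone : ∀ s, s.used = P.ρ → p s)
    (hround : ∀ s, LoopInv P s → s.used < P.ρ → (∀ e z, p (PaceGGM.updateState n P s e z)) → p s)
    {s : State d} (hs : LoopInv P s) : p s := by
  have key : ∀ (N : ℕ) (s : State d), LoopInv P s → P.ρ - s.used ≤ N * P.perRound → p s := by
    intro N
    induction N with
    | zero =>
      intro s hs hN
      refine hdone s (le_antisymm hs.used_le ?_)
      simpa using hN
    | succ N ih =>
      intro s hs hN
      rcases hs.used_le.eq_or_lt with heq | hlt
      · exact hdone s heq
      · refine hround s hs hlt fun e z => ih _ (hs.updateState hβ hlt e z) ?_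
        change P.ρ - (s.used + s.sel + s.meas) ≤ _
        push_cast at hN
        rcases hs.progress hlt with h | h
        · linarith
        · have : 0 ≤ (N : ℝ) * P.perRound := by positivity
          linarith
  obtain ⟨N, hN⟩ := exists_nat_ge ((P.ρ - s.used) / P.perRound)
  exact key N s hs ((div_le_iff₀ hc).1 hN)

lemma isProbabilityMeasure_bind {Ω Ω' : Type*} [MeasurableSpace Ω] [MeasurableSpace Ω']
    {μ : Measure Ω} [IsProbabilityMeasure μ] {κ : Ω → Measure Ω'} (hκ : Measurable κ)
    (h : ∀ a, IsProbabilityMeasure (κ a)) : IsProbabilityMeasure (μ.bind κ) := by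
  constructor
  rw [Measure.bind_apply MeasurableSet.univ hκ.aemeasurable]
  simp

section Privacy

variable {P : Params}

lemma nonempty_entry (hd : 1 ≤ d) : Nonempty (Entry d) := ⟨diagEntry ⟨0, hd⟩⟩

lemma measurable_loopLaw_updateState (X : Dataset n d P.B) (s : State d) (e : Entry d) :
    Measurable fun z => loopLaw X (updateState n P s e z) :=
  (measurable_loopLaw X).comp (measurable_updateState_right P s e)

lemma isProbabilityMeasure_loopLaw (hd : 1 ≤ d) (hc : 0 < P.perRound) (hβ : 0 < P.β ∧ P.β < 1)
    (X : Dataset n d P.B) {s : State d} (hs : LoopInv P s) :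
    IsProbabilityMeasure (loopLaw X s) := by
  have := nonempty_entry hd
  refine LoopInv.induction (n := n) (p := fun s => IsProbabilityMeasure (loopLaw X s)) hc hβ
    (fun s hs => ?_) (fun s _ hlt ih => ?_) hs
  · rw [loopLaw_of_le X hs.ge]
    infer_instance
  · rw [loopLaw_of_lt X hlt]
    have : IsProbabilityMeasure (selectLaw P X s) := isProbabilityMeasure_expMechanism _ _
    exact isProbabilityMeasure_bind Measurable.of_discrete fun e =>
      isProbabilityMeasure_bind (measurable_loopLaw_updateState X s e) fun z => ih e z

lemma Params.sens_pos (hn : 1 ≤ n) (hB : 0 < P.B) : 0 < P.sens n := by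
  have : (0 : ℝ) < n := by exact_mod_cast hn
  unfold Params.sens
  positivity

/-- The variance `Δ² / (2 r)` is calibrated so that measuring a quantity of sensitivity `Δ` with
Gaussian noise costs `r`. -/
lemma dualRenyiBound_gaussianReal_calibrated {γ : ℝ} (hγ : 1 < γ) {m m' Δ r : ℝ} (hΔ : 0 < Δ)
    (hr : 0 < r) (h : |m - m'| ≤ Δ) :
    DualRenyiBound γ r (gaussianReal m (Δ ^ 2 / (2 * r)).toNNReal)
      (gaussianReal m' (Δ ^ 2 / (2 * r)).toNNReal) := by
  have hv : 0 < Δ ^ 2 / (2 * r) := by positivity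
  refine dualRenyiBound_gaussianReal hγ (Real.toNNReal_pos.2 hv).ne' ?_
  rw [Real.coe_toNNReal _ hv.le, div_le_iff₀ (by positivity)]
  have h1 : r * (2 * (Δ ^ 2 / (2 * r))) = Δ ^ 2 := by field_simp
  rw [h1]
  exact sq_le_sq' (abs_le.1 h).1 (abs_le.1 h).2

/-- The parameter `ε = √(8 ρ_sel)` makes the selection cost `ε² / 8 = ρ_sel`; the scores inherit the
sensitivity of the entries since the estimate is the same for both datasets. -/
lemma dualRenyiBound_selectLaw {γ : ℝ} (hγ : 1 < γ) (hn : 1 ≤ n) (hd : 1 ≤ d) (hB : 0 < P.B)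
    {X X' : Dataset n d P.B} (hX : Neighboring X X') {s : State d} (hs : 0 < s.sel) :
    DualRenyiBound γ s.sel (selectLaw P X s) (selectLaw P X' s) := by
  have := nonempty_entry hd
  have hΔ := Params.sens_pos hn hB
  have key := dualRenyiBound_expMechanism hγ (c := Real.sqrt (8 * s.sel) / (2 * P.sens n))
    (δ := P.sens n) (by positivity)
    (score := fun e => |entryOf (secondMoment X) e - entryOf s.est e|)
    (score' := fun e => |entryOf (secondMoment X') e - entryOf s.est e|) fun e => by
      refine (abs_abs_sub_abs_le_abs_sub _ _).trans ?_
      rw [sub_sub_sub_cancel_right]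
      exact abs_secondMoment_sub_le hX _ _
  have hcost : (2 * (Real.sqrt (8 * s.sel) / (2 * P.sens n)) * P.sens n) ^ 2 / 8 = s.sel := by
    have h1 : 2 * (Real.sqrt (8 * s.sel) / (2 * P.sens n)) * P.sens n = Real.sqrt (8 * s.sel) := by
      field_simp
    rw [h1, Real.sq_sqrt (by positivity)]
    ring
  rwa [hcost] at key

/-- From a state with used budget `s.used`, the loop costs at most the remaining budget. The used
budget after a round depends on the state before it only, so that the cost of the remaining rounds
is bounded uniformly over the outcomes of the round although later budgets are adaptive. -/
lemma dualRenyiBound_loopLaw {γ : ℝ} (hγ : 1 < γ) (hn : 1 ≤ n) (hd : 1 ≤ d) (hB : 0 < P.B)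
    (hc : 0 < P.perRound) (hβ : 0 < P.β ∧ P.β < 1) {X X' : Dataset n d P.B}
    (hX : Neighboring X X') {s : State d} (hs : LoopInv P s) :
    DualRenyiBound γ (P.ρ - s.used) (loopLaw X s) (loopLaw X' s) := by
  refine LoopInv.induction (n := n)
    (p := fun s => DualRenyiBound γ (P.ρ - s.used) (loopLaw X s) (loopLaw X' s)) hc hβ
    (fun s hs => ?_) (fun s hs hlt ih => ?_) hs
  · rw [loopLaw_of_le X hs.ge, loopLaw_of_le X' hs.ge, hs, sub_self]
    exact dualRenyiBound_dirac hγ s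
  · rw [loopLaw_of_lt X hlt, loopLaw_of_lt X' hlt]
    have key := (dualRenyiBound_selectLaw hγ hn hd hB hX (hs.sel_pos hlt)).bind hγ
      Measurable.of_discrete Measurable.of_discrete fun e =>
      (dualRenyiBound_gaussianReal_calibrated hγ (Params.sens_pos hn hB) (hs.meas_pos hlt)
        (abs_secondMoment_sub_le hX e.1.1 e.1.2)).bind hγ
        (measurable_loopLaw_updateState X s e) (measurable_loopLaw_updateState X' s e)
        fun z => show DualRenyiBound γ (P.ρ - (s.used + s.sel + s.meas)) _ _ from ih e z
    refine key.mono hγ (le_of_eq ?_)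
    ring

/-- The initialization measures `d` diagonal entries at cost `α ρ / d` each. -/
lemma dualRenyiBound_initNoise {γ : ℝ} (hγ : 1 < γ) (hn : 1 ≤ n) (hd : 1 ≤ d) (hB : 0 < P.B)
    (hρ : 0 < P.ρ) (hα : 0 < P.α) {X X' : Dataset n d P.B} (hX : Neighboring X X') :
    DualRenyiBound γ (P.α * P.ρ)
      (Measure.pi fun j : Fin d => gaussianReal (secondMoment X j j) (P.diagVar n d).toNNReal)
      (Measure.pi fun j : Fin d =>
        gaussianReal (secondMoment X' j j) (P.diagVar n d).toNNReal) := by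
  have hd' : (0 : ℝ) < d := by exact_mod_cast hd
  have hvar : P.diagVar n d = P.sens n ^ 2 / (2 * (P.α * P.ρ / d)) := by
    rw [Params.diagVar, mul_div_assoc]
  rw [hvar]
  refine (DualRenyiBound.pi hγ fun j => dualRenyiBound_gaussianReal_calibrated hγ
    (Params.sens_pos hn hB) (by positivity) (abs_secondMoment_sub_le hX j j)).mono hγ (le_of_eq ?_)
  field_simp

lemma pace_eq (X : Dataset n d P.B) :
    pace P X = ((Measure.pi fun j : Fin d =>
      gaussianReal (secondMoment X j j) (P.diagVar n d).toNNReal).bind fun v =>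
        loopLaw X (initState n P v)).map State.est := by
  rw [pace, initLaw]
  exact congrArg (Measure.map State.est)
    (bind_map _ (measurable_initState P) (measurable_loopLaw X))

lemma measurable_loopLaw_initState (X : Dataset n d P.B) :
    Measurable fun v => loopLaw X (initState n P v) :=
  (measurable_loopLaw X).comp (measurable_initState P)

end Privacy

end PaceGGM

end
open PaceGGM in
theorem mainTheorem1 (n d : ℕ) (hn : 1 ≤ n) (hd : 1 ≤ d) (P : PaceGGM.Params)
    (hT : 1 ≤ P.T) (hρ : 0 < P.ρ) (hB : 0 < P.B)
    (hα : 0 < P.α ∧ P.α < 1) (hβ : 0 < P.β ∧ P.β < 1) :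
    (∀ X X' : Dataset n d P.B, Neighboring X X' →
      ∀ j k, |secondMoment X j k - secondMoment X' j k| ≤ 2 * P.B ^ 2 / n) ∧
    (∀ X : Dataset n d P.B, MeasureTheory.IsProbabilityMeasure (pace P X)) ∧
    IsZCDP Neighboring (pace (n := n) (d := d) P) P.ρ := by
  have hc := Params.perRound_pos hT hρ hα.2
  have hprob : ∀ X : Dataset n d P.B, MeasureTheory.IsProbabilityMeasure (pace P X) := by
    intro X
    rw [pace_eq]
    have := isProbabilityMeasure_bind (μ := MeasureTheory.Measure.pi fun j : Fin d =>
      ProbabilityTheory.gaussianReal (secondMoment X j j) (P.diagVar n d).toNNReal)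
      (measurable_loopLaw_initState X) fun v =>
        isProbabilityMeasure_loopLaw hd hc hβ X (loopInv_initState hT hρ hα.2 hβ v)
    exact MeasureTheory.Measure.isProbabilityMeasure_map measurable_state_est.aemeasurable
  refine ⟨fun X X' hX => abs_secondMoment_sub_le hX, hprob, fun X X' hX γ hγ => ?_⟩
  have := hprob X
  have := hprob X'
  refine DualRenyiBound.renyiDiv_le hγ ?_
  rw [pace_eq, pace_eq]
  refine DualRenyiBound.map ?_ measurable_state_est
  have key := (dualRenyiBound_initNoise hγ hn hd hB hρ hα.1 hX).bind hγ
    (measurable_loopLaw_initState X) (measurable_loopLaw_initState X') fun v =>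
      show DualRenyiBound γ (P.ρ - P.α * P.ρ) _ _ from
      dualRenyiBound_loopLaw hγ hn hd hB hc hβ hX (loopInv_initState hT hρ hα.2 hβ v)
  exact key.mono hγ (add_sub_cancel _ _).le
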